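/- **Theorem 1.1 (Decomposition of exact pfd bimodules).** Let $\mathbf k$ be a field and let $M$ be a persistence bimodule, i.e. a functor from $\mathbb R^2$ with the product order to $\mathbf k$-vector spaces, with structure maps $\rho_s^t\colon M_s\to M_t$ for $s\le t$. Assume that $M$ is pointwise finite-dimensional ($\dim M_t<\infty$ for all $t$) and exact, i.e. for all $s\le t$ in $\mathbb R^2$ the sequence $$M_s\xrightarrow{\ \phi\ }M_{(t_x,s_y)}\oplus M_{(s_x,t_y)}\xrightarrow{\ \psi\ }M_t,\qquad \phi=\bigl(\rho_s^{(t_x,s_y)},\rho_s^{(s_x,t_y)}\bigr),\quad \psi=\rho_{(t_x,s_y)}^t-\rho_{(s_x,t_y)}^t,$$ satisfies $\operatorname{Im}\phi=\operatorname{Ker}\psi$. A decorated real is $-\infty$, $+\infty$, or one of the symbols $x^\downarrow,x^\uparrow$ with $x\in\mathbb R$, compared with reals by $x^\downarrow<x<x^\uparrow<y^\downarrow<y<y^\uparrow$ for $x<y$, and $-\infty<z<+\infty$ for $z\in\mathbb R$. A shape $S$ is a type (birth quadrant, death quadrant, horizontal band or vertical band) together with two decorated reals $c,d$; its support is, respectively,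 $\{t\in\mathbb R^2: c\le t_x,\ d\le t_y\}$, $\{t: t_x\le c,\ t_y\le d\}$, $\{t: c\le t_y\le d\}$, $\{t: c\le t_x\le d\}$. The block module $M_S$ has a copy of $\mathbf k$ at every point of the support and $0$ elsewhere, the copies of $\mathbf k$ being connected by identities and all other maps being zero. Then there is a family $(B_i)_{i\in I}$ of shapes with non-empty supports (a multiset of shapes) such that $$M\;\cong\;\bigoplus_{i\in I}M_{B_i}.$$ The decomposition is unique up to isomorphism and reordering of the terms: if $M\cong\bigoplus_{j\in J}N_j$, where either all $N_j$ are block modules of shapes with non-empty support, or, more generally, all $N_j$ are indecomposable bimodules, then there is a bijection $e\colon J\to I$ with $N_j\cong M_{B_{e(j)}}$ for all $j\in J$. -/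

import Mathlib

open CategoryTheory
open scoped DirectSum

universe u v w

/- `ℝ × ℝ` is regarded as the category of its product order, not as a product of two categories. -/
attribute [instance 2000] Preorder.smallCategory

/-- A persistence bimodule over `k`: a functor from `ℝ × ℝ` with the product order
to the category of `k`-vector spaces. The category structure on `ℝ × ℝ` is the one of
the product order: there is an arrow `s ⟶ t` exactly when `s ≤ t`, and it is then unique. -/
abbrev PersistenceBimodule (k : Type u) [Field k] : Type (max u (v + 1)) :=
  (ℝ × ℝ) ⥤ ModuleCat.{v} k

namespace PersistenceBimodule

variable {k : Type u} [Field k]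

/-- The structure map `ρ_s^t : M_s → M_t`, for `s ≤ t`. -/
def rho (M : PersistenceBimodule.{u, v} k) {s t : ℝ × ℝ} (h : s ≤ t) :
    M.obj s →ₗ[k] M.obj t :=
  (M.map (homOfLE h)).hom

/-- Pointwise finite-dimensional. -/
def IsPfd (M : PersistenceBimodule.{u, v} k) : Prop :=
  ∀ t : ℝ × ℝ, Module.Finite k (M.obj t)

/-- For `s ≤ t`, the map `φ = (h, v) : M_s → M_{(t_x, s_y)} × M_{(s_x, t_y)}`. -/
def phi (M : PersistenceBimodule.{u, v} k) {s t : ℝ × ℝ} (h : s ≤ t) :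
    M.obj s →ₗ[k] M.obj (t.1, s.2) × M.obj (s.1, t.2) :=
  LinearMap.prod
    (M.rho (s := s) (t := (t.1, s.2)) ⟨h.1, le_rfl⟩)
    (M.rho (s := s) (t := (s.1, t.2)) ⟨le_rfl, h.2⟩)

/-- For `s ≤ t`, the map `ψ = v - h : M_{(t_x, s_y)} × M_{(s_x, t_y)} → M_t`. -/
def psi (M : PersistenceBimodule.{u, v} k) {s t : ℝ × ℝ} (h : s ≤ t) :
    M.obj (t.1, s.2) × M.obj (s.1, t.2) →ₗ[k] M.obj t :=
  LinearMap.coprod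
    (M.rho (s := (t.1, s.2)) (t := t) ⟨le_rfl, h.2⟩)
    (-M.rho (s := (s.1, t.2)) (t := t) ⟨h.1, le_rfl⟩)

/-- Exactness of a bimodule: `Im φ = Ker ψ` for all `s ≤ t`. -/
def IsExact (M : PersistenceBimodule.{u, v} k) : Prop :=
  ∀ (s t : ℝ × ℝ) (h : s ≤ t), LinearMap.range (M.phi h) = LinearMap.ker (M.psi h)

open Classical in
/-- The pointwise direct sum of a family of bimodules. -/
noncomputable def directSum {J : Type w} (N : J → PersistenceBimodule.{u, v} k) :
    PersistenceBimodule.{u, max w v} k where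
  obj t := ModuleCat.of k (⨁ j, (N j).obj t)
  map f := ModuleCat.ofHom (DirectSum.lmap fun j => ((N j).map f).hom)
  map_id t := by
    ext1
    refine DirectSum.linearMap_ext k fun j => LinearMap.ext fun x => ?_
    simp
  map_comp f g := by
    ext1
    refine DirectSum.linearMap_ext k fun j => LinearMap.ext fun x => ?_
    simp [DirectSum.lmap_lof]

open Classical in
/-- The space at `t` of the module supported on `S`: `k` if `t ∈ S`, and `0` otherwise. -/
noncomputable def supportSpace (k : Type u) [Field k] (S : Set (ℝ × ℝ)) (t : ℝ × ℝ) :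
    Submodule k k :=
  if t ∈ S then ⊤ else ⊥

open Classical in
/-- The map from `s` to `t` of the module supported on `S`: the identity of `k` if `s` and `t`
both lie in `S`, and `0` otherwise. -/
noncomputable def supportMap (k : Type u) [Field k] (S : Set (ℝ × ℝ)) (s t : ℝ × ℝ) :
    supportSpace k S s →ₗ[k] supportSpace k S t :=
  if h : s ∈ S ∧ t ∈ S then
    Submodule.inclusion (by simp [supportSpace, h.1, h.2])
  else 0

theorem eq_zero_of_notMem {S : Set (ℝ × ℝ)} {t : ℝ × ℝ} (ht : t ∉ S)
    (x : supportSpace k S t) : x = 0 := by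
  obtain ⟨x, hx⟩ := x
  have : x = 0 := by simpa [supportSpace, ht] using hx
  exact Subtype.ext this

/-- The module with `k` at every point of `S` and `0` elsewhere, the copies of `k` being
connected by identities; it is a functor when `S` is convex for the product order. -/
noncomputable def supportModule (k : Type u) [Field k] (S : Set (ℝ × ℝ))
    (hS : S.OrdConnected) : PersistenceBimodule.{u, u} k where
  obj t := ModuleCat.of k (supportSpace k S t)
  map {s t} _ := ModuleCat.ofHom (supportMap k S s t)
  map_id t := by
    ext1
    refine LinearMap.ext fun x => ?_
    by_cases ht : t ∈ S
    · apply Subtype.ext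
      simp [supportMap, ht]
    · rw [eq_zero_of_notMem ht x]
      simp
  map_comp {r s t} f g := by
    ext1
    refine LinearMap.ext fun x => ?_
    by_cases hr : r ∈ S
    · by_cases ht : t ∈ S
      · have hs : s ∈ S := hS.out hr ht ⟨leOfHom f, leOfHom g⟩
        apply Subtype.ext
        simp [supportMap, hr, hs, ht]
      · exact (eq_zero_of_notMem ht _).trans (eq_zero_of_notMem ht _).symm
    · rw [eq_zero_of_notMem hr x]
      simp

end PersistenceBimodule

/-- Decorated reals, including the two infinite ones (which carry no decoration):
`down x` is `x^↓` (just below `x`) and `up x` is `x^↑` (just above `x`). -/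
inductive DecoratedReal where
  | negInf : DecoratedReal
  | down (x : ℝ) : DecoratedReal
  | up (x : ℝ) : DecoratedReal
  | posInf : DecoratedReal

namespace DecoratedReal

/-- `c.LeReal z` means `c ≤ z`, for a decorated real `c` and a real `z`. -/
def LeReal : DecoratedReal → ℝ → Prop
  | negInf, _ => True
  | down x, z => x ≤ z
  | up x, z => x < z
  | posInf, _ => False

/-- `c.GeReal z` means `z ≤ c`, for a decorated real `c` and a real `z`. -/
def GeReal : DecoratedReal → ℝ → Prop
  | negInf, _ => False
  | down x, z => z < x
  | up x, z => z ≤ x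
  | posInf, _ => True

theorem LeReal.mono {c : DecoratedReal} {z z' : ℝ} (h : c.LeReal z) (hz : z ≤ z') :
    c.LeReal z' := by
  cases c with
  | negInf => trivial
  | down x => exact le_trans (show x ≤ z from h) hz
  | up x => exact lt_of_lt_of_le (show x < z from h) hz
  | posInf => exact h

theorem GeReal.mono {c : DecoratedReal} {z z' : ℝ} (h : c.GeReal z') (hz : z ≤ z') :
    c.GeReal z := by
  cases c with
  | negInf => exact h
  | down x => exact lt_of_le_of_lt hz (show z' < x from h)
  | up x => exact le_trans hz (show z' ≤ x from h)
  | posInf => trivial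

end DecoratedReal

/-- The four shape types. -/
inductive ShapeType where
  | birthQuadrant : ShapeType
  | deathQuadrant : ShapeType
  | horizontalBand : ShapeType
  | verticalBand : ShapeType

/-- A shape: a shape type and two decorated reals. -/
structure Shape where
  type : ShapeType
  x : DecoratedReal
  y : DecoratedReal

namespace Shape

/-- The support of a shape. -/
def supp : Shape → Set (ℝ × ℝ)
  | ⟨.birthQuadrant, x, y⟩ => {t | x.LeReal t.1 ∧ y.LeReal t.2}
  | ⟨.deathQuadrant, x, y⟩ => {t | x.GeReal t.1 ∧ y.GeReal t.2}
  | ⟨.horizontalBand, x, y⟩ => {t | x.LeReal t.2 ∧ y.GeReal t.2}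
  | ⟨.verticalBand, x, y⟩ => {t | x.LeReal t.1 ∧ y.GeReal t.1}

theorem ordConnected_supp (s : Shape) : s.supp.OrdConnected := by
  refine ⟨fun a ha b hb t ht => ?_⟩
  obtain ⟨⟨h1, h2⟩, ⟨h3, h4⟩⟩ := ht
  obtain ⟨_ | _ | _ | _, x, y⟩ := s
  · exact ⟨ha.1.mono h1, ha.2.mono h2⟩
  · exact ⟨hb.1.mono h3, hb.2.mono h4⟩
  · exact ⟨ha.1.mono h2, hb.2.mono h4⟩
  · exact ⟨ha.1.mono h1, hb.2.mono h3⟩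

/-- The block module of a shape. -/
noncomputable def blockModule (k : Type u) [Field k] (s : Shape) :
    PersistenceBimodule.{u, u} k :=
  PersistenceBimodule.supportModule k s.supp s.ordConnected_supp

end Shape

/-!
# Decomposition of exact pointwise finite-dimensional bimodules

Write `Kerₕ`, `Imₕ`, `Kerᵥ`, `Imᵥ` for the kernels and images at a point `t` of the horizontal and
vertical structure maps out of and into `M_t`. In an exact bimodule `Kerₕ ≤ Imᵥ` and `Kerᵥ ≤ Imₕ`
for all targets and sources. So each `M_t` carries two flags: `flagX`, the kernels `Kerₕ` followed
by the images `Imᵥ`, and `flagY`, the kernels `Kerᵥ` followed by the images `Imₕ`, both indexed by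
`ℝ ⊕ₗ ℝ`. Two flags of a finite-dimensional space always have a common adapted basis, obtained by
lifting bases of the pieces of the bigraded space, which are indexed by the pairs of cuts of the
index set (`Flag.exists_basis_sigma`).

A pair of cuts `p` lies inside the flags exactly over a product of two intervals, `cellRegion p`,
which is the support of a block: according to whether each cut lies among the kernels or among the
images, it is a death quadrant, a vertical band, a horizontal band or a birth quadrant
(`exists_shape_supp_eq`). Exactness says that vertical maps push the first flag forward onto the
first flag and pull the second flag back to the second flag, and the other way round for horizontal
maps. Therefore the structure maps induce isomorphisms of the piece at `p` over `cellRegion p`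
(`IsExact.isQuotEquiv_rho`), and even surjections of the subspaces `Flag.cellUpper` above it. As
these regions have decreasing coinitial sequences, bases of the pieces can be lifted compatibly
(`IsExact.exists_basis_cell`), and since elements of the cell die outside the region, each lifted
basis vector spans a block module. Together they decompose `M`.

For uniqueness, block supports are closed under infima, so endomorphisms of block modules are
scalars, and an endomorphism of a block factoring through a block with a different support is zero
(`coeffAt_comp_eq_zero`). Hence the change between two decompositions is given by an invertible
matrix already on the finitely many summands with a fixed support, and their numbers agree
(`Decomposition.exists_equiv_support_eq`). An indecomposable summand of `M` is a retract, hence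
again exact and pointwise finite-dimensional. By existence it is a direct sum of blocks, so it is
a single block, which reduces the general uniqueness to that for blocks.
-/

-- Without this priority the quiver underlying a reflexive quiver is found first in `X ⟶ Y`.
attribute [local instance 2000] CategoryStruct.toQuiver

/-! ### Two flags in a finite-dimensional space -/

namespace Flag

section

variable {k V W L L' : Type*} [Field k] [AddCommGroup V] [Module k V] [AddCommGroup W] [Module k W]
  [LinearOrder L] [LinearOrder L']

/-- The intersection of the members of the flag `F` above the cut of `L` whose upper part
is `U`. -/
def upper (F : L → Submodule k V) (U : UpperSet L) : Submodule k V :=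
  ⨅ a ∈ U, F a

/-- The sum of the members of the flag `F` below the cut of `L` whose upper part is `U`. -/
def lower (F : L → Submodule k V) (U : UpperSet L) : Submodule k V :=
  ⨆ (a : L) (_ : a ∉ U), F a

theorem upper_le {F : L → Submodule k V} {U : UpperSet L} {a : L} (ha : a ∈ U) :
    upper F U ≤ F a :=
  iInf₂_le a ha

theorem le_lower {F : L → Submodule k V} {U : UpperSet L} {a : L} (ha : a ∉ U) :
    F a ≤ lower F U :=
  le_iSup₂ (f := fun (a : L) (_ : a ∉ U) => F a) a ha

theorem lower_le_upper {F : L → Submodule k V} (hF : Monotone F) (U : UpperSet L) :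
    lower F U ≤ upper F U :=
  iSup₂_le fun _ ha => le_iInf₂ fun _ hb =>
    hF (le_of_not_ge fun h => ha (U.upper h hb))

theorem upper_le_lower {F : L → Submodule k V} {U U' : UpperSet L} (h : U' < U) :
    upper F U' ≤ lower F U := by
  obtain ⟨a, ha, ha'⟩ := Set.exists_of_ssubset (UpperSet.coe_ssubset_coe.2 h)
  exact (upper_le ha).trans (le_lower ha')

/-- In a finite-dimensional space the infimum defining `upper F U` is attained, and from some
point on downwards it is attained by every member of `U`. -/
theorem exists_upper_eq [FiniteDimensional k V] {F : L → Submodule k V} (hF : Monotone F)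
    {U : UpperSet L} (hU : (U : Set L).Nonempty) :
    ∃ a ∈ U, ∀ b ∈ U, b ≤ a → upper F U = F b := by
  obtain ⟨_, ⟨a, ha, rfl⟩, hmin⟩ :=
    (wellFounded_lt (α := Submodule k V)).has_min (F '' U) (hU.image F)
  refine ⟨a, ha, fun b hb hba => le_antisymm (upper_le hb) (le_iInf₂ fun c hc => ?_)⟩
  rcases le_total b c with h | h
  · exact hF h
  · rw [(hF (h.trans hba)).eq_of_not_lt (hmin _ ⟨c, hc, rfl⟩)]
    exact hF hba

theorem exists_lower_eq [FiniteDimensional k V] {F : L → Submodule k V} (hF : Monotone F)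
    {U : UpperSet L} (hU : ∃ a, a ∉ U) :
    ∃ a ∉ U, ∀ b ∉ U, a ≤ b → lower F U = F b := by
  obtain ⟨_, ⟨a, ha, rfl⟩, hmax⟩ :=
    (wellFounded_gt (α := Submodule k V)).has_min (F '' (U : Set L)ᶜ)
      (hU.elim fun a ha => ⟨F a, a, ha, rfl⟩)
  refine ⟨a, ha, fun b hb hab => le_antisymm (iSup₂_le fun c hc => ?_) (le_lower hb)⟩
  rcases le_total c b with h | h
  · exact hF h
  · rw [← (hF (hab.trans h)).eq_of_not_lt (hmax _ ⟨c, hc, rfl⟩)]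
    exact hF hab

/-- The upper space of the cell of a pair of cuts of two flags. -/
def cellUpper (F : L → Submodule k V) (F' : L' → Submodule k V)
    (p : UpperSet L × UpperSet L') : Submodule k V :=
  upper F p.1 ⊓ upper F' p.2

/-- The lower space of the cell of a pair of cuts of two flags: the quotient of
`cellUpper F F' p` by it is the piece of the bigraded space of the two flags at `p`. -/
def cellLower (F : L → Submodule k V) (F' : L' → Submodule k V)
    (p : UpperSet L × UpperSet L') : Submodule k V :=
  (lower F p.1 ⊓ upper F' p.2) ⊔ (upper F p.1 ⊓ lower F' p.2)

theorem cellLower_le_cellUpper {F : L → Submodule k V} {F' : L' → Submodule k V}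
    (hF : Monotone F) (hF' : Monotone F') (p : UpperSet L × UpperSet L') :
    cellLower F F' p ≤ cellUpper F F' p :=
  sup_le (inf_le_inf_right _ (lower_le_upper hF _)) (inf_le_inf_left _ (lower_le_upper hF' _))

end

end Flag

/-- The family `e` lies in `P` and its classes form a basis of `P / N`. -/
structure IsBasisMod {k V κ : Type*} [Field k] [AddCommGroup V] [Module k V]
    (P N : Submodule k V) (e : κ → V) : Prop where
  mem : ∀ i, e i ∈ P
  le_sup : P ≤ Submodule.span k (Set.range e) ⊔ N
  eq_zero : ∀ c : κ →₀ k, Finsupp.linearCombination k e c ∈ N → c = 0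

namespace IsBasisMod

variable {k V W κ : Type*} [Field k] [AddCommGroup V] [Module k V] [AddCommGroup W] [Module k W]

theorem exists_fin [FiniteDimensional k V] (P N : Submodule k V) (h : N ≤ P) :
    ∃ (n : ℕ) (e : Fin n → V), IsBasisMod P N e := by
  obtain ⟨Q, hQ⟩ := Submodule.exists_isCompl N
  let b := Module.finBasis k (P ⊓ Q : Submodule k V)
  have hspan : Submodule.span k (Set.range fun i => (b i : V)) = P ⊓ Q := by
    have := congrArg (Submodule.map (P ⊓ Q).subtype) b.span_eq
    rwa [Submodule.map_span, Submodule.map_top, Submodule.range_subtype, ← Set.range_comp] at this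
  refine ⟨_, fun i => (b i : V), fun i => (b i).2.1, ?_, fun c hc => ?_⟩
  · rw [hspan, sup_comm, inf_comm, ← sup_inf_assoc_of_le Q h, hQ.sup_eq_top, top_inf_eq]
  · have hmem : Finsupp.linearCombination k (fun i => (b i : V)) c ∈ Q := by
      have := LinearMap.mem_range_self (Finsupp.linearCombination k fun i => (b i : V)) c
      rw [Finsupp.range_linearCombination, hspan] at this
      exact this.2
    have h0 := Submodule.disjoint_def.1 hQ.disjoint _ hc hmem
    have hli : LinearIndependent k fun i => (b i : V) :=
      b.linearIndependent.map' (P ⊓ Q).subtype (Submodule.ker_subtype _)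
    exact linearIndependent_iff.1 hli c h0

theorem linearIndependent {P N : Submodule k V} {e : κ → V} (h : IsBasisMod P N e) :
    LinearIndependent k e :=
  linearIndependent_iff.2 fun c hc => h.eq_zero c (hc ▸ N.zero_mem)

theorem eq_zero_of_mem_span {P N : Submodule k V} {e : κ → V} (h : IsBasisMod P N e) {v : V}
    (hv : v ∈ Submodule.span k (Set.range e)) (hN : v ∈ N) : v = 0 := by
  obtain ⟨c, rfl⟩ := (Finsupp.mem_span_range_iff_exists_finsupp).1 hv
  have := h.eq_zero c (by rwa [Finsupp.linearCombination_apply])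
  simp [this]

end IsBasisMod

/-- The map `f` carries `P` onto `P'` and `N` into `N'`, and induces an isomorphism from `P / N` to
`P' / N'`. -/
structure IsQuotEquiv {k V W : Type*} [Field k] [AddCommGroup V] [Module k V] [AddCommGroup W]
    [Module k W] (f : V →ₗ[k] W) (P N : Submodule k V) (P' N' : Submodule k W) : Prop where
  map_eq : P.map f = P'
  map_le : N.map f ≤ N'
  comap_inf_le : N'.comap f ⊓ P ≤ N

theorem IsQuotEquiv.comp {k V W X : Type*} [Field k] [AddCommGroup V] [Module k V]
    [AddCommGroup W] [Module k W] [AddCommGroup X] [Module k X] {f : V →ₗ[k] W} {g : W →ₗ[k] X}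
    {P N : Submodule k V} {P' N' : Submodule k W} {P'' N'' : Submodule k X}
    (hg : IsQuotEquiv g P' N' P'' N'') (hf : IsQuotEquiv f P N P' N') :
    IsQuotEquiv (g ∘ₗ f) P N P'' N'' where
  map_eq := by rw [Submodule.map_comp, hf.map_eq, hg.map_eq]
  map_le := by
    rw [Submodule.map_comp]
    exact (Submodule.map_mono hf.map_le).trans hg.map_le
  comap_inf_le := fun v ⟨hv, hvP⟩ =>
    hf.comap_inf_le ⟨hg.comap_inf_le ⟨hv, hf.map_eq ▸ Submodule.mem_map_of_mem hvP⟩, hvP⟩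

namespace IsBasisMod

variable {k V W κ : Type*} [Field k] [AddCommGroup V] [Module k V] [AddCommGroup W] [Module k W]
  {P N : Submodule k V} {P' N' : Submodule k W} {f : V →ₗ[k] W}

theorem map {e : κ → V} (h : IsBasisMod P N e) (hf : IsQuotEquiv f P N P' N') :
    IsBasisMod P' N' (f ∘ e) where
  mem i := hf.map_eq ▸ Submodule.mem_map_of_mem (h.mem i)
  le_sup := by
    rw [← hf.map_eq, Set.range_comp, ← Submodule.map_span]
    refine (Submodule.map_mono h.le_sup).trans ?_
    rw [Submodule.map_sup]
    exact sup_le_sup_left hf.map_le _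
  eq_zero c hc := by
    refine h.eq_zero c (hf.comap_inf_le ⟨?_, ?_⟩)
    · rwa [SetLike.mem_coe, Submodule.mem_comap, Finsupp.apply_linearCombination]
    · exact Submodule.span_le.2 (Set.range_subset_iff.2 h.mem)
        (Finsupp.mem_span_range_iff_exists_finsupp.2 ⟨c, rfl⟩)

theorem lift {e' : κ → W} (h : IsBasisMod P' N' e') (hf : IsQuotEquiv f P N P' N') :
    ∃ e : κ → V, f ∘ e = e' ∧ IsBasisMod P N e := by
  have hlift : ∀ i, ∃ v ∈ P, f v = e' i := fun i => by
    have := h.mem i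
    rwa [← hf.map_eq, Submodule.mem_map] at this
  choose e heP he using hlift
  have hfe : f ∘ e = e' := funext he
  refine ⟨e, hfe, heP, fun v hv => ?_, fun c hc => h.eq_zero c ?_⟩
  · have hfv : f v ∈ P' := hf.map_eq ▸ Submodule.mem_map_of_mem hv
    obtain ⟨x, hx, y, hy, hxy⟩ := Submodule.mem_sup.1 (h.le_sup hfv)
    rw [← hfe, Set.range_comp, ← Submodule.map_span] at hx
    obtain ⟨z, hz, rfl⟩ := hx
    have hzP : z ∈ P := Submodule.span_le.2 (Set.range_subset_iff.2 heP) hz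
    have : v - z ∈ N := by
      refine hf.comap_inf_le ⟨?_, P.sub_mem hv hzP⟩
      rw [SetLike.mem_coe, Submodule.mem_comap, map_sub, ← hxy, add_sub_cancel_left]
      exact hy
    exact Submodule.mem_sup.2 ⟨z, hz, v - z, this, by abel⟩
  · rw [← hfe, ← Finsupp.apply_linearCombination]
    exact hf.map_le (Submodule.mem_map_of_mem hc)

end IsBasisMod

namespace Flag

section

variable {k V W L L' : Type*} [Field k] [AddCommGroup V] [Module k V] [AddCommGroup W] [Module k W]
  [LinearOrder L] [LinearOrder L']

/-- Vectors representing bases of the pieces of the bigraded space of two flags span the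
space. -/
theorem span_eq_top [FiniteDimensional k V] {F : L → Submodule k V} {F' : L' → Submodule k V}
    (hF : Monotone F) (hF' : Monotone F') (htop : ∃ a, F a = ⊤) (htop' : ∃ a, F' a = ⊤)
    {S : Submodule k V} (hS : ∀ p, cellUpper F F' p ≤ S ⊔ cellLower F F' p) : S = ⊤ := by
  -- Well-founded induction on the pair `(F a, F' b)`: at the cuts just below `F a` and `F' b` the
  -- lower spaces are strictly smaller members of the flags, or zero.
  have key : ∀ x : Submodule k V × Submodule k V, ∀ a b, F a = x.1 → F' b = x.2 →
      F a ⊓ F' b ≤ S := by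
    intro x
    induction x using WellFoundedLT.induction with
    | ind x ih =>
    obtain ⟨A, B⟩ := x
    rintro a b rfl rfl
    let U : UpperSet L := ⟨{c | F a ≤ F c}, fun c d hcd hc => le_trans hc (hF hcd)⟩
    let U' : UpperSet L' := ⟨{c | F' b ≤ F' c}, fun c d hcd hc => le_trans hc (hF' hcd)⟩
    have hU : upper F U = F a := le_antisymm (upper_le (le_refl (F a))) (le_iInf₂ fun c hc => hc)
    have hU' : upper F' U' = F' b :=
      le_antisymm (upper_le (le_refl (F' b))) (le_iInf₂ fun c hc => hc)
    have h1 : lower F U ⊓ F' b ≤ S := by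
      by_cases hne : ∃ c, c ∉ U
      · obtain ⟨c, hc, hcl⟩ := exists_lower_eq hF hne
        rw [hcl c hc le_rfl]
        have hlt : F c < F a :=
          lt_of_le_not_ge (hF (le_of_not_ge fun h => hc (hF h))) hc
        exact ih (F c, F' b) (Prod.mk_lt_mk.2 (Or.inl ⟨hlt, le_rfl⟩)) c b rfl rfl
      · push Not at hne
        simp [lower, hne]
    have h2 : F a ⊓ lower F' U' ≤ S := by
      by_cases hne : ∃ c, c ∉ U'
      · obtain ⟨c, hc, hcl⟩ := exists_lower_eq hF' hne
        rw [hcl c hc le_rfl]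
        have hlt : F' c < F' b :=
          lt_of_le_not_ge (hF' (le_of_not_ge fun h => hc (hF' h))) hc
        exact ih (F a, F' c) (Prod.mk_lt_mk.2 (Or.inr ⟨le_rfl, hlt⟩)) a c rfl rfl
      · push Not at hne
        simp [lower, hne]
    have h3 := hS (U, U')
    simp only [cellUpper, cellLower, hU, hU'] at h3
    exact h3.trans (sup_le le_rfl (sup_le h1 h2))
  obtain ⟨a, ha⟩ := htop
  obtain ⟨b, hb⟩ := htop'
  simpa [ha, hb] using key (F a, F' b) a b rfl rfl

/-- Vectors representing bases of the pieces of the bigraded space of two flags are linearly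
independent: in a relation, the lexicographically highest piece cannot be cancelled by the
others. -/
theorem iSupIndep_span {F : L → Submodule k V} {F' : L' → Submodule k V}
    (hF' : Monotone F') {D : Set (UpperSet L × UpperSet L')} {κ : D → Type*}
    {e : ∀ d, κ d → V}
    (he : ∀ d : D, IsBasisMod (cellUpper F F' d) (cellLower F F' d) (e d)) :
    iSupIndep fun d => Submodule.span k (Set.range (e d)) := by
  classical
  have hmem : ∀ d v, v ∈ Submodule.span k (Set.range (e d)) → v ∈ cellUpper F F' d :=
    fun d v hv => Submodule.span_le.2 (Set.range_subset_iff.2 (he d).mem) hv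
  rw [iSupIndep_iff_finsetSum_eq_zero_imp_eq_zero]
  intro s v hv hsum
  by_contra! hne
  obtain ⟨d₀, hd₀, hvd₀⟩ := hne
  obtain ⟨d, hd, hmax⟩ := (s.filter fun d => v d ≠ 0).exists_max_image
    (fun d => toLex (d : UpperSet L × UpperSet L')) ⟨d₀, by simp [hd₀, hvd₀]⟩
  obtain ⟨hds, hvd⟩ := Finset.mem_filter.1 hd
  refine hvd ((he d).eq_zero_of_mem_span (hv d hds) ?_)
  have hrest : -v d ∈ lower F d.1.1 ⊔ (upper F d.1.1 ⊓ lower F' d.1.2) := by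
    have : -v d = ∑ i ∈ s.erase d, v i := by
      rw [neg_eq_iff_add_eq_zero, Finset.add_sum_erase _ _ hds, hsum]
    rw [this]
    refine Submodule.sum_mem _ fun i hi => ?_
    obtain ⟨hid, his⟩ := Finset.mem_erase.1 hi
    by_cases hvi : v i = 0
    · rw [hvi]
      exact Submodule.zero_mem _
    have hlt : toLex (i : UpperSet L × UpperSet L') < toLex d.1 :=
      lt_of_le_of_ne (hmax i (Finset.mem_filter.2 ⟨his, hvi⟩))
        fun h => hid (Subtype.ext (toLex.injective h))
    have hvi' := hmem i _ (hv i his)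
    rcases Prod.Lex.toLex_lt_toLex.1 hlt with h | ⟨h, h'⟩
    · exact Submodule.mem_sup_left (upper_le_lower h hvi'.1)
    · exact Submodule.mem_sup_right ⟨h ▸ hvi'.1, upper_le_lower h' hvi'.2⟩
  obtain ⟨x, hx, y, hy, hxy⟩ := Submodule.mem_sup.1 hrest
  have hxU : x ∈ upper F' d.1.2 := by
    rw [eq_sub_of_add_eq hxy]
    exact Submodule.sub_mem _ (Submodule.neg_mem _ (hmem d _ (hv d hds)).2)
      (lower_le_upper hF' _ hy.2)
  rw [← neg_mem_iff, ← hxy]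
  exact Submodule.add_mem_sup ⟨hx, hxU⟩ hy

/-- Representatives of bases of the pieces of the bigraded space of two flags form together a basis
of the space. -/
theorem exists_basis_sigma [FiniteDimensional k V] {F : L → Submodule k V}
    {F' : L' → Submodule k V} (hF : Monotone F) (hF' : Monotone F') (htop : ∃ a, F a = ⊤)
    (htop' : ∃ a, F' a = ⊤) {D : Set (UpperSet L × UpperSet L')} {κ : D → Type*}
    {e : ∀ d, κ d → V}
    (he : ∀ d : D, IsBasisMod (cellUpper F F' d) (cellLower F F' d) (e d))
    (hD : ∀ p ∉ D, cellUpper F F' p ≤ cellLower F F' p) :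
    ∃ b : Module.Basis (Σ d, κ d) k V, ⇑b = fun x : Σ d, κ d => e x.1 x.2 := by
  classical
  have hsup : ⨆ d, Submodule.span k (Set.range (e d)) = ⊤ := by
    refine span_eq_top hF hF' htop htop' fun p => ?_
    by_cases hp : p ∈ D
    · exact (he ⟨p, hp⟩).le_sup.trans (sup_le_sup_right
        (le_iSup (fun d => Submodule.span k (Set.range (e d))) ⟨p, hp⟩) _)
    · exact (hD p hp).trans le_sup_right
  have hint := DirectSum.isInternal_submodule_of_iSupIndep_of_iSup_eq_top
    (iSupIndep_span hF' he) hsup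
  refine ⟨hint.collectedBasis fun d => Module.Basis.span (he d).linearIndependent, ?_⟩
  rw [DirectSum.IsInternal.collectedBasis_coe]
  exact funext fun x => congrArg Subtype.val
    (Module.Basis.span_apply (he x.1).linearIndependent x.2)

variable {F : L → Submodule k V} {F' : L' → Submodule k V} {G : L → Submodule k W}
  {G' : L' → Submodule k W} {f : V →ₗ[k] W}

theorem map_upper [FiniteDimensional k V] [FiniteDimensional k W] (hF : Monotone F)
    (hG : Monotone G) {U : UpperSet L} {c : L} (hc : c ∈ U) (h : ∀ a ≤ c, (F a).map f = G a) :
    (upper F U).map f = upper G U := by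
  obtain ⟨a, ha, hFa⟩ := exists_upper_eq hF ⟨c, hc⟩
  obtain ⟨b, hb, hGb⟩ := exists_upper_eq hG ⟨c, hc⟩
  have hm : min c (min a b) ∈ U := min_rec' (· ∈ U) hc (min_rec' (· ∈ U) ha hb)
  rw [hFa _ hm ((min_le_right _ _).trans (min_le_left _ _)),
    hGb _ hm ((min_le_right _ _).trans (min_le_right _ _)), h _ (min_le_left _ _)]

theorem comap_upper [FiniteDimensional k V] [FiniteDimensional k W] (hF : Monotone F)
    (hG : Monotone G) {U : UpperSet L} {c : L} (hc : c ∉ U) (hU : (U : Set L).Nonempty)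
    (h : ∀ a, c ≤ a → (G a).comap f = F a) : (upper G U).comap f = upper F U := by
  obtain ⟨a, ha, hFa⟩ := exists_upper_eq hF hU
  obtain ⟨b, hb, hGb⟩ := exists_upper_eq hG hU
  have hm : min a b ∈ U := min_rec' (· ∈ U) ha hb
  rw [hFa _ hm (min_le_left _ _), hGb _ hm (min_le_right _ _),
    h _ (le_of_not_ge fun h => hc (U.upper h hm))]

theorem map_lower [FiniteDimensional k V] [FiniteDimensional k W] (hF : Monotone F)
    (hG : Monotone G) {U : UpperSet L} {c : L} (hc : c ∈ U) (hU : ∃ a, a ∉ U)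
    (h : ∀ a ≤ c, (F a).map f = G a) : (lower F U).map f = lower G U := by
  obtain ⟨a, ha, hFa⟩ := exists_lower_eq hF hU
  obtain ⟨b, hb, hGb⟩ := exists_lower_eq hG hU
  have hm : max a b ∉ U := max_rec' (· ∉ U) ha hb
  rw [hFa _ hm (le_max_left _ _), hGb _ hm (le_max_right _ _),
    h _ (le_of_not_ge fun h => hm (U.upper h hc))]

theorem comap_lower [FiniteDimensional k V] [FiniteDimensional k W] (hF : Monotone F)
    (hG : Monotone G) {U : UpperSet L} {c : L} (hc : c ∉ U)
    (h : ∀ a, c ≤ a → (G a).comap f = F a) : (lower G U).comap f = lower F U := by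
  obtain ⟨a, ha, hFa⟩ := exists_lower_eq hF ⟨c, hc⟩
  obtain ⟨b, hb, hGb⟩ := exists_lower_eq hG ⟨c, hc⟩
  have hm : max c (max a b) ∉ U := max_rec' (· ∉ U) hc (max_rec' (· ∉ U) ha hb)
  rw [hFa _ hm ((le_max_left _ _).trans (le_max_right _ _)),
    hGb _ hm ((le_max_right _ _).trans (le_max_right _ _)), h _ (le_max_left _ _)]

/-- If `f` carries one pair of subspaces of `V` onto the corresponding one of `W`, and the other
pair is the preimage of the corresponding one of `W`, then `f` induces an isomorphism of the
intersections of the larger subspaces modulo the sum of the mixed intersections. -/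
theorem isQuotEquiv_inf {A A₀ C C₀ : Submodule k V} {A' A₀' C' C₀' : Submodule k W}
    (hA₀ : A₀ ≤ A) (hA : A.map f = A') (hA₀' : A₀.map f = A₀')
    (hC : C'.comap f = C) (hC₀ : C₀'.comap f = C₀) :
    IsQuotEquiv f (A ⊓ C) ((A₀ ⊓ C) ⊔ (A ⊓ C₀)) (A' ⊓ C') ((A₀' ⊓ C') ⊔ (A' ⊓ C₀')) := by
  have hinf : ∀ (P : Submodule k V) (Q : Submodule k W), (P ⊓ Q.comap f).map f = P.map f ⊓ Q := by
    refine fun P Q => le_antisymm ?_ ?_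
    · rintro _ ⟨w, ⟨hwP, hwQ⟩, rfl⟩
      exact ⟨Submodule.mem_map_of_mem hwP, hwQ⟩
    · rintro _ ⟨⟨w, hwP, rfl⟩, hwQ⟩
      exact Submodule.mem_map_of_mem ⟨hwP, hwQ⟩
  subst hA hA₀' hC hC₀
  refine ⟨hinf _ _, by rw [Submodule.map_sup, hinf, hinf], ?_⟩
  rintro w ⟨hw, hwA, hwC⟩
  obtain ⟨p, ⟨⟨p, hp, rfl⟩, hpC⟩, q, ⟨⟨q, hq, rfl⟩, hqC⟩, hpq⟩ :=
    Submodule.mem_sup.1 (Submodule.mem_comap.1 hw)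
  have hsub : w - p ∈ A ⊓ C₀'.comap f := by
    refine ⟨A.sub_mem hwA (hA₀ hp), ?_⟩
    rw [SetLike.mem_coe, Submodule.mem_comap, map_sub, ← hpq, add_sub_cancel_left]
    exact hqC
  exact Submodule.mem_sup.2 ⟨p, ⟨hp, hpC⟩, w - p, hsub, by abel⟩

/-- A map under which the first flag is pushed forward up to a level above the first cut, and the
second flag is pulled back from a level below the second cut, induces an isomorphism of the
pieces of the bigraded spaces. -/
theorem isQuotEquiv_cell [FiniteDimensional k V] [FiniteDimensional k W] (hF : Monotone F)
    (hG : Monotone G) (hF' : Monotone F') (hG' : Monotone G') {p : UpperSet L × UpperSet L'}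
    {c : L} (hc : c ∈ p.1) (hp₁ : ∃ a, a ∉ p.1) (hmap : ∀ a ≤ c, (F a).map f = G a)
    {c' : L'} (hc' : c' ∉ p.2) (hp₂ : (p.2 : Set L').Nonempty)
    (hcomap : ∀ a, c' ≤ a → (G' a).comap f = F' a) :
    IsQuotEquiv f (cellUpper F F' p) (cellLower F F' p) (cellUpper G G' p) (cellLower G G' p) :=
  isQuotEquiv_inf (lower_le_upper hF _) (map_upper hF hG hc hmap) (map_lower hF hG hc hp₁ hmap)
    (comap_upper hF' hG' hc' hp₂ hcomap) (comap_lower hF' hG' hc' hcomap)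

theorem cellUpper_swap (p : UpperSet L × UpperSet L') :
    cellUpper F' F p.swap = cellUpper F F' p :=
  inf_comm _ _

theorem cellLower_swap (p : UpperSet L × UpperSet L') :
    cellLower F' F p.swap = cellLower F F' p := by
  rw [cellLower, cellLower, sup_comm, inf_comm, inf_comm (lower F' _)]
  rfl

end

end Flag

/-! ### The two flags of an exact bimodule -/

namespace PersistenceBimodule

section

variable {k : Type u} [Field k] (M : PersistenceBimodule.{u, v} k)

theorem rho_self (t : ℝ × ℝ) (v : M.obj t) : M.rho (le_refl t) v = v :=
  congrArg (fun f => f.hom v) (M.map_id t)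

theorem rho_rho {r s t : ℝ × ℝ} (h : r ≤ s) (h' : s ≤ t) (v : M.obj r) :
    M.rho h' (M.rho h v) = M.rho (h.trans h') v :=
  congrArg (fun f => f.hom v) (M.map_comp (homOfLE h) (homOfLE h')).symm

variable {M}

theorem IsExact.exists_of_rho_eq (hM : M.IsExact) {x x' y y' : ℝ} (hx : x ≤ x') (hy : y ≤ y')
    {a : M.obj (x', y)} {b : M.obj (x, y')}
    (hab : M.rho (s := (x', y)) (t := (x', y')) ⟨le_rfl, hy⟩ a =
      M.rho (s := (x, y')) (t := (x', y')) ⟨hx, le_rfl⟩ b) :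
    ∃ w : M.obj (x, y), M.rho (s := (x, y)) (t := (x', y)) ⟨hx, le_rfl⟩ w = a ∧
      M.rho (s := (x, y)) (t := (x, y')) ⟨le_rfl, hy⟩ w = b := by
  have hmem : (a, b) ∈ LinearMap.ker (M.psi (s := (x, y)) (t := (x', y')) ⟨hx, hy⟩) := by
    simp only [psi, LinearMap.mem_ker, LinearMap.coprod_apply, LinearMap.neg_apply]
    rw [hab]
    exact add_neg_cancel _
  rw [← hM] at hmem
  obtain ⟨w, hw⟩ := hmem
  exact ⟨w, congrArg Prod.fst hw, congrArg Prod.snd hw⟩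

variable (M)

/-- The first flag at `t`: first the kernels of the horizontal maps out of `M_t`, increasing with
their target, then the images of the vertical maps into `M_t`, increasing with their source.
Targets to the left of `t` and sources above `t` are replaced by `t` itself. -/
def flagX (t : ℝ × ℝ) (a : ℝ ⊕ₗ ℝ) : Submodule k (M.obj t) :=
  Sum.elim
    (fun x => LinearMap.ker (M.rho (s := t) (t := (max t.1 x, t.2)) ⟨le_max_left _ _, le_rfl⟩))
    (fun y => LinearMap.range (M.rho (s := (t.1, min t.2 y)) (t := t) ⟨le_rfl, min_le_left _ _⟩))
    (ofLex a)

/-- The second flag at `t`, with the two coordinates exchanged: kernels of vertical maps, then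
images of horizontal maps. -/
def flagY (t : ℝ × ℝ) (a : ℝ ⊕ₗ ℝ) : Submodule k (M.obj t) :=
  Sum.elim
    (fun y => LinearMap.ker (M.rho (s := t) (t := (t.1, max t.2 y)) ⟨le_rfl, le_max_left _ _⟩))
    (fun x => LinearMap.range (M.rho (s := (min t.1 x, t.2)) (t := t) ⟨min_le_left _ _, le_rfl⟩))
    (ofLex a)

variable {M} {s t : ℝ × ℝ}

theorem mem_flagX_inl {x : ℝ} {v : M.obj t} :
    v ∈ M.flagX t (Sum.inlₗ x) ↔
      ∀ z (hz : t.1 ≤ z), x ≤ z → M.rho (s := t) (t := (z, t.2)) ⟨hz, le_rfl⟩ v = 0 := by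
  refine ⟨fun h z hz hxz => ?_, fun h => h _ (le_max_left _ _) (le_max_right _ _)⟩
  have h' : M.rho (s := t) (t := (max t.1 x, t.2)) ⟨le_max_left _ _, le_rfl⟩ v = 0 := h
  rw [← M.rho_rho (r := t) (s := (max t.1 x, t.2)) (t := (z, t.2)) ⟨le_max_left _ _, le_rfl⟩
    ⟨max_le hz hxz, le_rfl⟩ v, h', map_zero]

theorem mem_flagX_inr {y : ℝ} {v : M.obj t} :
    v ∈ M.flagX t (Sum.inrₗ y) ↔
      ∃ z, ∃ hz : z ≤ t.2, z ≤ y ∧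
        ∃ w : M.obj (t.1, z), M.rho (s := (t.1, z)) (t := t) ⟨le_rfl, hz⟩ w = v := by
  refine ⟨fun ⟨w, hw⟩ => ⟨_, min_le_left _ _, min_le_right _ _, w, hw⟩, ?_⟩
  rintro ⟨z, hz, hzy, w, rfl⟩
  exact ⟨M.rho (s := (t.1, z)) (t := (t.1, min t.2 y)) ⟨le_rfl, le_min hz hzy⟩ w, M.rho_rho _ _ _⟩

theorem mem_flagY_inl {y : ℝ} {v : M.obj t} :
    v ∈ M.flagY t (Sum.inlₗ y) ↔
      ∀ z (hz : t.2 ≤ z), y ≤ z → M.rho (s := t) (t := (t.1, z)) ⟨le_rfl, hz⟩ v = 0 := by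
  refine ⟨fun h z hz hyz => ?_, fun h => h _ (le_max_left _ _) (le_max_right _ _)⟩
  have h' : M.rho (s := t) (t := (t.1, max t.2 y)) ⟨le_rfl, le_max_left _ _⟩ v = 0 := h
  rw [← M.rho_rho (r := t) (s := (t.1, max t.2 y)) (t := (t.1, z)) ⟨le_rfl, le_max_left _ _⟩
    ⟨le_rfl, max_le hz hyz⟩ v, h', map_zero]

theorem mem_flagY_inr {x : ℝ} {v : M.obj t} :
    v ∈ M.flagY t (Sum.inrₗ x) ↔
      ∃ z, ∃ hz : z ≤ t.1, z ≤ x ∧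
        ∃ w : M.obj (z, t.2), M.rho (s := (z, t.2)) (t := t) ⟨hz, le_rfl⟩ w = v := by
  refine ⟨fun ⟨w, hw⟩ => ⟨_, min_le_left _ _, min_le_right _ _, w, hw⟩, ?_⟩
  rintro ⟨z, hz, hzx, w, rfl⟩
  exact ⟨M.rho (s := (z, t.2)) (t := (min t.1 x, t.2)) ⟨le_min hz hzx, le_rfl⟩ w, M.rho_rho _ _ _⟩

theorem IsExact.monotone_flagX (hM : M.IsExact) (t : ℝ × ℝ) : Monotone (M.flagX t) := by
  intro a b hab v hv
  induction a using Lex.rec with | _ a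
  induction b using Lex.rec with | _ b
  obtain x | y := a <;> obtain x' | y' := b
  · rw [Sum.Lex.inl_le_inl_iff] at hab
    rw [mem_flagX_inl] at hv ⊢
    exact fun z hz hxz => hv z hz (hab.trans hxz)
  · have hv' := mem_flagX_inl.1 hv _ (le_max_left t.1 x) (le_max_right t.1 x)
    obtain ⟨w, -, hw⟩ := hM.exists_of_rho_eq (le_max_left t.1 x) (min_le_left t.2 y')
      (a := 0) (b := v) (by rw [hv', map_zero])
    exact mem_flagX_inr.2 ⟨_, min_le_left _ _, min_le_right _ _, w, hw⟩
  · exact absurd hab Sum.Lex.not_inr_le_inl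
  · rw [Sum.Lex.inr_le_inr_iff] at hab
    obtain ⟨z, hz, hzy, w⟩ := mem_flagX_inr.1 hv
    exact mem_flagX_inr.2 ⟨z, hz, hzy.trans hab, w⟩

theorem IsExact.monotone_flagY (hM : M.IsExact) (t : ℝ × ℝ) : Monotone (M.flagY t) := by
  intro a b hab v hv
  induction a using Lex.rec with | _ a
  induction b using Lex.rec with | _ b
  obtain y | x := a <;> obtain y' | x' := b
  · rw [Sum.Lex.inl_le_inl_iff] at hab
    rw [mem_flagY_inl] at hv ⊢
    exact fun z hz hyz => hv z hz (hab.trans hyz)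
  · have hv' := mem_flagY_inl.1 hv _ (le_max_left t.2 y) (le_max_right t.2 y)
    obtain ⟨w, hw, -⟩ := hM.exists_of_rho_eq (min_le_left t.1 x') (le_max_left t.2 y)
      (a := v) (b := 0) (by rw [hv', map_zero])
    exact mem_flagY_inr.2 ⟨_, min_le_left _ _, min_le_right _ _, w, hw⟩
  · exact absurd hab Sum.Lex.not_inr_le_inl
  · rw [Sum.Lex.inr_le_inr_iff] at hab
    obtain ⟨z, hz, hzx, w⟩ := mem_flagY_inr.1 hv
    exact mem_flagY_inr.2 ⟨z, hz, hzx.trans hab, w⟩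

theorem map_flagX_le (h : s ≤ t) (a : ℝ ⊕ₗ ℝ) :
    (M.flagX s a).map (M.rho h) ≤ M.flagX t a := by
  rintro _ ⟨v, hv, rfl⟩
  induction a using Lex.rec with | _ a
  obtain x | y := a
  · refine mem_flagX_inl.2 fun z hz hxz => ?_
    rw [M.rho_rho, ← M.rho_rho (r := s) (s := (z, s.2)) (t := (z, t.2))
      ⟨h.1.trans hz, le_rfl⟩ ⟨le_rfl, h.2⟩, mem_flagX_inl.1 hv z (h.1.trans hz) hxz, map_zero]
  · obtain ⟨z, hz, hzy, w, rfl⟩ := mem_flagX_inr.1 hv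
    refine mem_flagX_inr.2
      ⟨z, hz.trans h.2, hzy, M.rho (s := (s.1, z)) (t := (t.1, z)) ⟨h.1, le_rfl⟩ w, ?_⟩
    rw [M.rho_rho, M.rho_rho]

theorem map_flagY_le (h : s ≤ t) (a : ℝ ⊕ₗ ℝ) :
    (M.flagY s a).map (M.rho h) ≤ M.flagY t a := by
  rintro _ ⟨v, hv, rfl⟩
  induction a using Lex.rec with | _ a
  obtain y | x := a
  · refine mem_flagY_inl.2 fun z hz hyz => ?_
    rw [M.rho_rho, ← M.rho_rho (r := s) (s := (s.1, z)) (t := (t.1, z))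
      ⟨le_rfl, h.2.trans hz⟩ ⟨h.1, le_rfl⟩, mem_flagY_inl.1 hv z (h.2.trans hz) hyz, map_zero]
  · obtain ⟨z, hz, hzx, w, rfl⟩ := mem_flagY_inr.1 hv
    refine mem_flagY_inr.2
      ⟨z, hz.trans h.1, hzx, M.rho (s := (z, s.2)) (t := (z, t.2)) ⟨le_rfl, h.2⟩ w, ?_⟩
    rw [M.rho_rho, M.rho_rho]

theorem IsExact.map_flagX_vertical (hM : M.IsExact) {x y y' : ℝ} (hy : y ≤ y') {a : ℝ ⊕ₗ ℝ}
    (ha : a ≤ Sum.inrₗ y) :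
    (M.flagX (x, y) a).map (M.rho (s := (x, y)) (t := (x, y')) ⟨le_rfl, hy⟩) =
      M.flagX (x, y') a := by
  refine le_antisymm (map_flagX_le _ a) fun v hv => ?_
  induction a using Lex.rec with | _ a
  obtain x' | y'' := a
  · have hv' := mem_flagX_inl.1 hv _ (le_max_left x x') (le_max_right x x')
    obtain ⟨w, hw0, hw⟩ := hM.exists_of_rho_eq (le_max_left x x') hy (a := 0) (b := v)
      (by rw [map_zero]; exact hv'.symm)
    exact ⟨w, hw0, hw⟩
  · rw [Sum.Lex.inr_le_inr_iff] at ha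
    obtain ⟨z, hz, hzy, w, rfl⟩ := mem_flagX_inr.1 hv
    exact ⟨_, mem_flagX_inr.2 ⟨z, hzy.trans ha, hzy, w, rfl⟩, M.rho_rho _ _ _⟩

theorem IsExact.map_flagY_horizontal (hM : M.IsExact) {x x' y : ℝ} (hx : x ≤ x') {a : ℝ ⊕ₗ ℝ}
    (ha : a ≤ Sum.inrₗ x) :
    (M.flagY (x, y) a).map (M.rho (s := (x, y)) (t := (x', y)) ⟨hx, le_rfl⟩) =
      M.flagY (x', y) a := by
  refine le_antisymm (map_flagY_le _ a) fun v hv => ?_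
  induction a using Lex.rec with | _ a
  obtain y' | x'' := a
  · have hv' := mem_flagY_inl.1 hv _ (le_max_left y y') (le_max_right y y')
    obtain ⟨w, hw, hw0⟩ := hM.exists_of_rho_eq hx (le_max_left y y') (a := v) (b := 0)
      (by rw [map_zero]; exact hv')
    exact ⟨w, hw0, hw⟩
  · rw [Sum.Lex.inr_le_inr_iff] at ha
    obtain ⟨z, hz, hzx, w, rfl⟩ := mem_flagY_inr.1 hv
    exact ⟨_, mem_flagY_inr.2 ⟨z, hzx.trans ha, hzx, w, rfl⟩, M.rho_rho _ _ _⟩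

theorem IsExact.comap_flagY_vertical (hM : M.IsExact) {x y y' : ℝ} (hy : y ≤ y') {a : ℝ ⊕ₗ ℝ}
    (ha : Sum.inlₗ y' ≤ a) :
    (M.flagY (x, y') a).comap (M.rho (s := (x, y)) (t := (x, y')) ⟨le_rfl, hy⟩) =
      M.flagY (x, y) a := by
  refine le_antisymm (fun v hv => ?_) (Submodule.map_le_iff_le_comap.1 (map_flagY_le _ a))
  rw [Submodule.mem_comap] at hv
  induction a using Lex.rec with | _ a
  obtain y'' | x' := a
  · rw [Sum.Lex.inl_le_inl_iff] at ha
    refine mem_flagY_inl.2 fun z hz hyz => ?_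
    have := mem_flagY_inl.1 hv z (ha.trans hyz) hyz
    rwa [M.rho_rho] at this
  · obtain ⟨z, hz, hzx, w, hw⟩ := mem_flagY_inr.1 hv
    obtain ⟨r, hr, -⟩ := hM.exists_of_rho_eq hz hy hw.symm
    exact mem_flagY_inr.2 ⟨z, hz, hzx, r, hr⟩

theorem IsExact.comap_flagX_horizontal (hM : M.IsExact) {x x' y : ℝ} (hx : x ≤ x') {a : ℝ ⊕ₗ ℝ}
    (ha : Sum.inlₗ x' ≤ a) :
    (M.flagX (x', y) a).comap (M.rho (s := (x, y)) (t := (x', y)) ⟨hx, le_rfl⟩) =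
      M.flagX (x, y) a := by
  refine le_antisymm (fun v hv => ?_) (Submodule.map_le_iff_le_comap.1 (map_flagX_le _ a))
  rw [Submodule.mem_comap] at hv
  induction a using Lex.rec with | _ a
  obtain x'' | y' := a
  · rw [Sum.Lex.inl_le_inl_iff] at ha
    refine mem_flagX_inl.2 fun z hz hxz => ?_
    have := mem_flagX_inl.1 hv z (ha.trans hxz) hxz
    rwa [M.rho_rho] at this
  · obtain ⟨z, hz, hzy, w, hw⟩ := mem_flagX_inr.1 hv
    obtain ⟨r, -, hr⟩ := hM.exists_of_rho_eq hx hz hw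
    exact mem_flagX_inr.2 ⟨z, hz, hzy, r, hr⟩

theorem flagX_inl_self (t : ℝ × ℝ) : M.flagX t (Sum.inlₗ t.1) = ⊥ :=
  (Submodule.eq_bot_iff _).2 fun v hv =>
    (M.rho_self t v).symm.trans (mem_flagX_inl.1 hv t.1 le_rfl le_rfl)

theorem flagY_inl_self (t : ℝ × ℝ) : M.flagY t (Sum.inlₗ t.2) = ⊥ :=
  (Submodule.eq_bot_iff _).2 fun v hv =>
    (M.rho_self t v).symm.trans (mem_flagY_inl.1 hv t.2 le_rfl le_rfl)

theorem flagX_inr_self (t : ℝ × ℝ) : M.flagX t (Sum.inrₗ t.2) = ⊤ :=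
  (Submodule.eq_top_iff').2 fun v => mem_flagX_inr.2 ⟨t.2, le_rfl, le_rfl, v, M.rho_self t v⟩

theorem flagY_inr_self (t : ℝ × ℝ) : M.flagY t (Sum.inrₗ t.1) = ⊤ :=
  (Submodule.eq_top_iff').2 fun v => mem_flagY_inr.2 ⟨t.1, le_rfl, le_rfl, v, M.rho_self t v⟩

end

end PersistenceBimodule

/-! ### Bases of the cells that are compatible with the structure maps -/

namespace PersistenceBimodule

section

/-- The set of points `t` for which the cuts `p.1` and `p.2` lie inside the flags at `t`, that is,
between `t.1` among the targets of maps and `t.2` among the sources, and the other way round. -/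
def cellRegion (p : UpperSet (ℝ ⊕ₗ ℝ) × UpperSet (ℝ ⊕ₗ ℝ)) : Set (ℝ × ℝ) :=
  {x | Sum.inlₗ x ∉ p.1 ∧ Sum.inrₗ x ∈ p.2} ×ˢ {y | Sum.inlₗ y ∉ p.2 ∧ Sum.inrₗ y ∈ p.1}

theorem exists_antitone_coinitial {X : Set ℝ} [X.OrdConnected] (hX : X.Nonempty) :
    ∃ u : ℕ → ℝ, Antitone u ∧ (∀ n, u n ∈ X) ∧ ∀ z ∈ X, ∃ n, u n ≤ z := by
  have := hX.to_subtype
  obtain ⟨u, hu, hlim⟩ := Filter.exists_seq_antitone_tendsto_atTop_atBot X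
  refine ⟨fun n => u n, hu, fun n => (u n).2, fun z hz => ?_⟩
  exact (hlim.eventually (Filter.eventually_le_atBot ⟨z, hz⟩)).exists

instance ordConnected_setOf_inl_inr (U U' : UpperSet (ℝ ⊕ₗ ℝ)) :
    {x : ℝ | Sum.inlₗ x ∉ U ∧ Sum.inrₗ x ∈ U'}.OrdConnected :=
  ⟨fun _ hx _ hy _ hz =>
    ⟨fun h => hy.1 (U.upper (Sum.Lex.inl_le_inl_iff.2 hz.2) h),
      U'.upper (Sum.Lex.inr_le_inr_iff.2 hz.1) hx.2⟩⟩

variable {k : Type u} [Field k] {M : PersistenceBimodule.{u, v} k}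
  {p : UpperSet (ℝ ⊕ₗ ℝ) × UpperSet (ℝ ⊕ₗ ℝ)} {s t : ℝ × ℝ}

theorem exists_antitone_coinitial_cellRegion (hp : (cellRegion p).Nonempty) :
    ∃ u : ℕ → ℝ × ℝ, Antitone u ∧ (∀ n, u n ∈ cellRegion p) ∧ ∀ z ∈ cellRegion p, ∃ n, u n ≤ z := by
  obtain ⟨a, ha, haX, hax⟩ := exists_antitone_coinitial hp.fst
  obtain ⟨b, hb, hbY, hby⟩ := exists_antitone_coinitial hp.snd
  refine ⟨fun n => (a n, b n), fun m n h => ⟨ha h, hb h⟩, fun n => ⟨haX n, hbY n⟩, fun z hz => ?_⟩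
  obtain ⟨m, hm⟩ := hax _ hz.1
  obtain ⟨n, hn⟩ := hby _ hz.2
  exact ⟨max m n, (ha (le_max_left m n)).trans hm, (hb (le_max_right m n)).trans hn⟩

theorem IsExact.isQuotEquiv_rho (hM : M.IsExact) (hpfd : M.IsPfd) (h : s ≤ t)
    (hs : s ∈ cellRegion p) (ht : t ∈ cellRegion p) :
    IsQuotEquiv (M.rho h)
      (Flag.cellUpper (M.flagX s) (M.flagY s) p) (Flag.cellLower (M.flagX s) (M.flagY s) p)
      (Flag.cellUpper (M.flagX t) (M.flagY t) p) (Flag.cellLower (M.flagX t) (M.flagY t) p) := by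
  obtain ⟨x, y⟩ := s
  obtain ⟨x', y'⟩ := t
  have := hpfd (x, y)
  have := hpfd (x', y)
  have := hpfd (x', y')
  have hhor : IsQuotEquiv (M.rho (s := (x, y)) (t := (x', y)) ⟨h.1, le_rfl⟩)
      (Flag.cellUpper (M.flagX (x, y)) (M.flagY (x, y)) p)
      (Flag.cellLower (M.flagX (x, y)) (M.flagY (x, y)) p)
      (Flag.cellUpper (M.flagX (x', y)) (M.flagY (x', y)) p)
      (Flag.cellLower (M.flagX (x', y)) (M.flagY (x', y)) p) := by
    have := Flag.isQuotEquiv_cell (hM.monotone_flagY (x, y)) (hM.monotone_flagY (x', y))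
      (hM.monotone_flagX (x, y)) (hM.monotone_flagX (x', y)) (p := p.swap) hs.1.2 ⟨_, hs.2.1⟩
      (fun a ha => hM.map_flagY_horizontal h.1 ha) ht.1.1 ⟨_, hs.2.2⟩
      (fun a ha => hM.comap_flagX_horizontal h.1 ha)
    simpa only [Flag.cellUpper_swap, Flag.cellLower_swap] using this
  have hver : IsQuotEquiv (M.rho (s := (x', y)) (t := (x', y')) ⟨le_rfl, h.2⟩)
      (Flag.cellUpper (M.flagX (x', y)) (M.flagY (x', y)) p)
      (Flag.cellLower (M.flagX (x', y)) (M.flagY (x', y)) p)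
      (Flag.cellUpper (M.flagX (x', y')) (M.flagY (x', y')) p)
      (Flag.cellLower (M.flagX (x', y')) (M.flagY (x', y')) p) :=
    Flag.isQuotEquiv_cell (hM.monotone_flagX (x', y)) (hM.monotone_flagX (x', y'))
      (hM.monotone_flagY (x', y)) (hM.monotone_flagY (x', y')) hs.2.2 ⟨_, ht.1.1⟩
      (fun a ha => hM.map_flagX_vertical h.2 ha) ht.2.1 ⟨_, ht.1.2⟩
      (fun a ha => hM.comap_flagY_vertical h.2 ha)
  have hcomp : M.rho h = M.rho (s := (x', y)) (t := (x', y')) ⟨le_rfl, h.2⟩ ∘ₗ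
      M.rho (s := (x, y)) (t := (x', y)) ⟨h.1, le_rfl⟩ :=
    LinearMap.ext fun v => (M.rho_rho _ _ v).symm
  rw [hcomp]
  exact hver.comp hhor

/-- Outside the region of a cell its piece of the bigraded space vanishes. -/
theorem cellUpper_le_cellLower (ht : t ∉ cellRegion p) :
    Flag.cellUpper (M.flagX t) (M.flagY t) p ≤ Flag.cellLower (M.flagX t) (M.flagY t) p := by
  by_cases h1 : Sum.inlₗ t.1 ∈ p.1
  · refine inf_le_left.trans ((Flag.upper_le h1).trans ?_)
    rw [flagX_inl_self]
    exact bot_le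
  by_cases h2 : Sum.inlₗ t.2 ∈ p.2
  · refine inf_le_right.trans ((Flag.upper_le h2).trans ?_)
    rw [flagY_inl_self]
    exact bot_le
  by_cases h3 : Sum.inrₗ t.2 ∈ p.1
  · have h4 : Sum.inrₗ t.1 ∉ p.2 := fun h4 => ht ⟨⟨h1, h4⟩, h2, h3⟩
    refine le_trans (inf_le_inf_left _ ?_) le_sup_right
    refine le_trans ?_ (Flag.le_lower h4)
    rw [flagY_inr_self]
    exact le_top
  · refine le_trans (inf_le_inf_right _ ?_) le_sup_left
    refine le_trans ?_ (Flag.le_lower h3)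
    rw [flagX_inr_self]
    exact le_top

/-- Elements of a cell die as soon as they leave its region. -/
theorem rho_eq_zero (h : s ≤ t) (hs : s ∈ cellRegion p) (ht : t ∉ cellRegion p) {v : M.obj s}
    (hv : v ∈ Flag.cellUpper (M.flagX s) (M.flagY s) p) : M.rho h v = 0 := by
  have h3 : Sum.inrₗ t.2 ∈ p.1 := p.1.upper (Sum.Lex.inr_le_inr_iff.2 h.2) hs.2.2
  have h4 : Sum.inrₗ t.1 ∈ p.2 := p.2.upper (Sum.Lex.inr_le_inr_iff.2 h.1) hs.1.2
  by_cases h1 : Sum.inlₗ t.1 ∈ p.1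
  · rw [← M.rho_rho (r := s) (s := (t.1, s.2)) (t := t) ⟨h.1, le_rfl⟩ ⟨le_rfl, h.2⟩,
      mem_flagX_inl.1 (Flag.upper_le h1 hv.1) t.1 h.1 le_rfl, map_zero]
  by_cases h2 : Sum.inlₗ t.2 ∈ p.2
  · rw [← M.rho_rho (r := s) (s := (s.1, t.2)) (t := t) ⟨le_rfl, h.2⟩ ⟨h.1, le_rfl⟩,
      mem_flagY_inl.1 (Flag.upper_le h2 hv.2) t.2 h.2 le_rfl, map_zero]
  exact absurd ⟨⟨h1, h4⟩, h2, h3⟩ ht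

/-- Over the region of a cell, bases of its pieces can be chosen compatibly with all structure
maps: lift a basis step by step along a decreasing coinitial sequence, and push the lifts
forward. -/
theorem IsExact.exists_basis_cell (hM : M.IsExact) (hpfd : M.IsPfd)
    (hp : (cellRegion p).Nonempty) :
    ∃ (n : ℕ) (e : ∀ t, Fin n → M.obj t),
      (∀ t ∈ cellRegion p, IsBasisMod (Flag.cellUpper (M.flagX t) (M.flagY t) p)
        (Flag.cellLower (M.flagX t) (M.flagY t) p) (e t)) ∧
      (∀ t ∉ cellRegion p, e t = 0) ∧
      ∀ s t (h : s ≤ t), s ∈ cellRegion p → ∀ i, M.rho h (e s i) = e t i := by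
  classical
  obtain ⟨u, hu, huR, hucof⟩ := exists_antitone_coinitial_cellRegion hp
  have := hpfd (u 0)
  obtain ⟨n, e₀, he₀⟩ := IsBasisMod.exists_fin _ _
    (Flag.cellLower_le_cellUpper (hM.monotone_flagX (u 0)) (hM.monotone_flagY (u 0)) p)
  let E : ℕ → Type _ := fun m => {e : Fin n → M.obj (u m) //
    IsBasisMod (Flag.cellUpper (M.flagX (u m)) (M.flagY (u m)) p)
      (Flag.cellLower (M.flagX (u m)) (M.flagY (u m)) p) e}
  have hstep : ∀ m (e : E m), ∃ e' : E (m + 1), M.rho (hu m.le_succ) ∘ e'.1 = e.1 := fun m e => by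
    obtain ⟨e', h, he'⟩ := e.2.lift (hM.isQuotEquiv_rho hpfd (hu m.le_succ) (huR _) (huR _))
    exact ⟨⟨e', he'⟩, h⟩
  choose next hnext using hstep
  let ε : ∀ m, E m := fun m => Nat.rec ⟨e₀, he₀⟩ next m
  have hε : ∀ {a b} (hab : a ≤ b) i, M.rho (hu hab) ((ε b).1 i) = (ε a).1 i := by
    intro a b hab i
    induction b, hab using Nat.le_induction with
    | base => exact M.rho_self _ _
    | succ b hab ih =>
      rw [← M.rho_rho (hu b.le_succ) (hu hab), ← ih]
      exact congrArg _ (congrFun (hnext b (ε b)) i)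
  have hεle : ∀ {a b : ℕ} {t : ℝ × ℝ} (ha : u a ≤ t) (hb : u b ≤ t) i,
      M.rho ha ((ε a).1 i) = M.rho hb ((ε b).1 i) := by
    intro a b t ha hb i
    rw [← hε (le_max_left a b), ← hε (le_max_right a b), M.rho_rho, M.rho_rho]
  let e : ∀ t, Fin n → M.obj t := fun t i =>
    if h : t ∈ cellRegion p then M.rho (hucof t h).choose_spec ((ε _).1 i) else 0
  have he : ∀ {t} (_ : t ∈ cellRegion p) {a} (ha : u a ≤ t) i,
      e t i = M.rho ha ((ε a).1 i) := fun ht a ha i => by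
    simp only [e, dif_pos ht]
    exact hεle _ _ i
  have hbasis : ∀ t ∈ cellRegion p, IsBasisMod (Flag.cellUpper (M.flagX t) (M.flagY t) p)
      (Flag.cellLower (M.flagX t) (M.flagY t) p) (e t) := fun t ht => by
    obtain ⟨a, ha⟩ := hucof t ht
    rw [show e t = M.rho ha ∘ (ε a).1 from funext (he ht ha)]
    exact (ε a).2.map (hM.isQuotEquiv_rho hpfd ha (huR a) ht)
  have hzero : ∀ t ∉ cellRegion p, e t = 0 := fun t ht => funext fun i => dif_neg ht
  refine ⟨n, e, hbasis, hzero, fun s t h hs i => ?_⟩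
  by_cases ht : t ∈ cellRegion p
  · obtain ⟨a, ha⟩ := hucof s hs
    rw [he hs ha, he ht (ha.trans h), M.rho_rho]
  · rw [hzero t ht, rho_eq_zero h hs ht ((hbasis s hs).mem i)]
    rfl

end

end PersistenceBimodule

/-! ### Inclusions and projections of direct sums -/

namespace PersistenceBimodule

section

variable {k : Type u} [Field k]

theorem rho_naturality {M N : PersistenceBimodule.{u, v} k} (f : M ⟶ N) {s t : ℝ × ℝ} (h : s ≤ t)
    (x : M.obj s) : (f.app t).hom (M.rho h x) = N.rho h ((f.app s).hom x) :=
  congrArg (fun g => g.hom x) (f.naturality (homOfLE h))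

theorem comp_app_hom_apply {M N P : PersistenceBimodule.{u, v} k} (f : M ⟶ N) (g : N ⟶ P)
    (t : ℝ × ℝ) (x : M.obj t) :
    ((f ≫ g).app t).hom x = (g.app t).hom ((f.app t).hom x) :=
  rfl

variable {J : Type w} {N : J → PersistenceBimodule.{u, max w v} k}

open Classical in
/-- The inclusion of a summand. -/
noncomputable def directSumι (N : J → PersistenceBimodule.{u, max w v} k) (j : J) :
    N j ⟶ directSum N where
  app t := ModuleCat.ofHom (DirectSum.lof k J (fun i => (N i).obj t) j)
  naturality s t f := by
    ext x
    exact (DirectSum.lmap_lof (fun i => ((N i).map f).hom) j x).symm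

/-- The projection to a summand. -/
noncomputable def directSumπ (N : J → PersistenceBimodule.{u, max w v} k) (j : J) :
    directSum N ⟶ N j where
  app t := ModuleCat.ofHom (DirectSum.component k J (fun i => (N i).obj t) j)
  naturality s t f := by
    ext x
    rfl

open Classical in
/-- The map out of a direct sum given by maps out of the summands. -/
noncomputable def directSumDesc {X : PersistenceBimodule.{u, max w v} k} (f : ∀ j, N j ⟶ X) :
    directSum N ⟶ X where
  app t := ModuleCat.ofHom (DirectSum.toModule k J (X.obj t) fun j => ((f j).app t).hom)
  naturality s t g := by
    ext1
    refine DirectSum.linearMap_ext k fun j => LinearMap.ext fun x => ?_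
    have h1 : (DirectSum.lmap fun i => ((N i).map g).hom) (DirectSum.lof k J _ j x) =
      DirectSum.lof k J (fun i => (N i).obj t) j (((N j).map g).hom x) := DirectSum.lmap_lof _ _ _
    have h2 := congrArg (fun h => h.hom x) ((f j).naturality g)
    change DirectSum.toModule k J (X.obj t) (fun j => ((f j).app t).hom)
        ((DirectSum.lmap fun i => ((N i).map g).hom) (DirectSum.lof k J _ j x)) =
      (X.map g).hom (DirectSum.toModule k J (X.obj s) (fun j => ((f j).app s).hom)
        (DirectSum.lof k J _ j x))
    rw [h1, DirectSum.toModule_lof, DirectSum.toModule_lof]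
    exact h2

theorem directSumι_π_self (j : J) : directSumι N j ≫ directSumπ N j = 𝟙 _ := by
  classical
  ext t x
  exact DirectSum.component.lof_self (R := k) (M := fun i => (N i).obj t) j x

theorem directSumι_π_of_ne {i j : J} (h : i ≠ j) : directSumι N i ≫ directSumπ N j = 0 := by
  classical
  ext t x
  exact (DirectSum.component.of (R := k) (M := fun i => (N i).obj t) j i x).trans (dif_neg h)

end

/-! ### Existence of the decomposition -/

section

variable {k : Type u} [Field k]

/-- The map out of the support module of `S` that sends the unit vectors to a given family of
elements compatible with the structure maps. -/
noncomputable def supportHom {M : PersistenceBimodule.{u, u} k} {S : Set (ℝ × ℝ)}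
    (hS : S.OrdConnected) (m : ∀ t, M.obj t) (hm₀ : ∀ t ∉ S, m t = 0)
    (hm : ∀ s t (h : s ≤ t), s ∈ S → M.rho h (m s) = m t) : supportModule k S hS ⟶ M where
  app t := ModuleCat.ofHom ((LinearMap.toSpanSingleton k (M.obj t) (m t)) ∘ₗ
    (supportSpace k S t).subtype)
  naturality s t f := by
    ext1
    refine LinearMap.ext fun (x : supportSpace k S s) => ?_
    change (supportMap k S s t x : k) • m t = M.rho (leOfHom f) ((x : k) • m s)
    by_cases hs : s ∈ S
    · rw [map_smul, hm s t _ hs]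
      by_cases ht : t ∈ S
      · simp [supportMap, hs, ht]
      · rw [hm₀ t ht, smul_zero, smul_zero]
    · rw [eq_zero_of_notMem hs x]
      simp

/-- A family of compatible elements of `M`, supported on blocks, whose nonzero members form a basis
at each point yields a decomposition of `M` into block modules. -/
theorem nonempty_iso_directSum_blockModule {M : PersistenceBimodule.{u, u} k} {I : Type}
    (B : I → Shape) (e : ∀ (_ : I) t, M.obj t) (he₀ : ∀ i, ∀ t ∉ (B i).supp, e i t = 0)
    (he : ∀ i s t (h : s ≤ t), s ∈ (B i).supp → M.rho h (e i s) = e i t)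
    (hli : ∀ t, LinearIndepOn k (fun i => e i t) {i | t ∈ (B i).supp})
    (hspan : ∀ t, Submodule.span k ((fun i => e i t) '' {i | t ∈ (B i).supp}) = ⊤) :
    Nonempty (M ≅ directSum fun i => (B i).blockModule k) := by
  classical
  let Φ : directSum (fun i => (B i).blockModule k) ⟶ M :=
    directSumDesc.{u, u, 0} fun i => supportHom (B i).ordConnected_supp (e i) (he₀ i) (he i)
  have happ : ∀ t (x : ⨁ i, supportSpace k (B i).supp t),
      (Φ.app t).hom x = DirectSum.toModule k I (M.obj t) (fun i =>
        (LinearMap.toSpanSingleton k (M.obj t) (e i t)) ∘ₗ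
          (supportSpace k (B i).supp t).subtype) x := fun t x => rfl
  have hbij : ∀ t, Function.Bijective (Φ.app t).hom := by
    refine fun t => ⟨?_, ?_⟩
    · rw [injective_iff_map_eq_zero]
      intro (x : ⨁ i, supportSpace k (B i).supp t) hx
      rw [happ] at hx
      replace hx := (DFinsupp.sumAddHom_apply _ _).symm.trans hx
      rw [DFinsupp.sum] at hx
      have hsub : ((DFinsupp.support x : Finset I) : Set I) ⊆ {i | t ∈ (B i).supp} :=
        fun i hi => by
          by_contra h
          exact (DFinsupp.mem_support_toFun _ _).1 hi (eq_zero_of_notMem h _)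
      have := linearIndepOn_iff'.1 (hli t) (DFinsupp.support x) (fun i => (x i : k)) hsub hx
      refine DFinsupp.ext fun i => ?_
      by_contra h
      exact h (Subtype.ext (this i ((DFinsupp.mem_support_toFun _ _).2 h)))
    · rw [← LinearMap.range_eq_top, eq_top_iff, ← hspan t, Submodule.span_le]
      rintro _ ⟨i, hi, rfl⟩
      have h1 : (1 : k) ∈ supportSpace k (B i).supp t := by
        simp [supportSpace, show t ∈ (B i).supp from hi]
      refine ⟨DirectSum.lof k I (fun i => supportSpace k (B i).supp t) i ⟨1, h1⟩, ?_⟩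
      rw [happ, DirectSum.toModule_lof]
      exact one_smul k _
  have : ∀ t, IsIso (Φ.app t) := fun t =>
    (ConcreteCategory.isIso_iff_bijective (Φ.app t)).2 (hbij t)
  have : IsIso Φ := NatIso.isIso_of_isIso_app Φ
  exact ⟨(asIso Φ).symm⟩

end

end PersistenceBimodule

namespace DecoratedReal

theorem exists_leReal_iff {X : Set ℝ} (hX : IsUpperSet X) :
    ∃ c : DecoratedReal, ∀ z, c.LeReal z ↔ z ∈ X := by
  rcases X.eq_empty_or_nonempty with rfl | hne
  · exact ⟨posInf, fun z => Iff.rfl⟩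
  by_cases hb : BddBelow X
  · have hglb := isGLB_csInf hne hb
    by_cases hm : sInf X ∈ X
    · exact ⟨down (sInf X), fun z => ⟨fun h => hX h hm, fun h => hglb.1 h⟩⟩
    · refine ⟨up (sInf X), fun z => ⟨fun h => ?_, fun h => ?_⟩⟩
      · obtain ⟨y, hy, hyz⟩ := (isGLB_lt_iff hglb).1 h
        exact hX hyz.le hy
      · exact lt_of_le_of_ne (hglb.1 h) fun heq => hm (heq ▸ h)
  · refine ⟨negInf, fun z => ⟨fun _ => ?_, fun _ => trivial⟩⟩
    obtain ⟨y, hy, hyz⟩ := not_bddBelow_iff.1 hb z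
    exact hX hyz.le hy

theorem exists_geReal_iff {X : Set ℝ} (hX : IsLowerSet X) :
    ∃ c : DecoratedReal, ∀ z, c.GeReal z ↔ z ∈ X := by
  obtain ⟨c, hc⟩ := exists_leReal_iff hX.compl
  have hnot : ∀ z, z ∈ X ↔ ¬c.LeReal z := fun z => by rw [hc]; exact not_not.symm
  refine ⟨c, fun z => Iff.trans ?_ (hnot z).symm⟩
  cases c <;> simp [GeReal, LeReal]

end DecoratedReal

namespace PersistenceBimodule

section

/-- The kind of the shape depends on whether each of the two cuts lies among the kernels or among
the images of its flag. -/
theorem exists_shape_supp_eq (p : UpperSet (ℝ ⊕ₗ ℝ) × UpperSet (ℝ ⊕ₗ ℝ)) :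
    ∃ B : Shape, B.supp = cellRegion p := by
  obtain ⟨U, U'⟩ := p
  have hlow : ∀ V : UpperSet (ℝ ⊕ₗ ℝ), IsLowerSet {x : ℝ | Sum.inlₗ x ∉ V} := fun V a b h ha hb =>
    ha (V.upper (Sum.Lex.inl_le_inl_iff.2 h) hb)
  have hup : ∀ V : UpperSet (ℝ ⊕ₗ ℝ), IsUpperSet {x : ℝ | Sum.inrₗ x ∈ V} := fun V a b h ha =>
    V.upper (Sum.Lex.inr_le_inr_iff.2 h) ha
  have hcut : ∀ V : UpperSet (ℝ ⊕ₗ ℝ),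
      (∀ x : ℝ, Sum.inrₗ x ∈ V) ∨ ∀ x : ℝ, Sum.inlₗ x ∉ V := fun V => by
    by_contra! h
    obtain ⟨⟨x, hx⟩, y, hy⟩ := h
    exact hx (V.upper (Sum.Lex.inl_le_inr y x) hy)
  obtain ⟨a, ha⟩ := DecoratedReal.exists_geReal_iff (hlow U)
  obtain ⟨b, hb⟩ := DecoratedReal.exists_leReal_iff (hup U)
  obtain ⟨c, hc⟩ := DecoratedReal.exists_geReal_iff (hlow U')
  obtain ⟨d, hd⟩ := DecoratedReal.exists_leReal_iff (hup U')
  rcases hcut U with h | h <;> rcases hcut U' with h' | h'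
  · exact ⟨⟨.deathQuadrant, a, c⟩, Set.ext fun t => by simp [Shape.supp, cellRegion, ha, hc, h, h']⟩
  · exact ⟨⟨.verticalBand, d, a⟩, Set.ext fun t => by
      simp [Shape.supp, cellRegion, ha, hd, h, h', and_comm]⟩
  · exact ⟨⟨.horizontalBand, b, c⟩, Set.ext fun t => by
      simp [Shape.supp, cellRegion, hb, hc, h, h', and_comm]⟩
  · exact ⟨⟨.birthQuadrant, d, b⟩, Set.ext fun t => by simp [Shape.supp, cellRegion, hb, hd, h, h']⟩

variable {k : Type u} [Field k] {M : PersistenceBimodule.{u, u} k}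

theorem IsExact.exists_iso_directSum_blockModule (hM : M.IsExact) (hpfd : M.IsPfd) :
    ∃ (I : Type) (B : I → Shape), (∀ i, (B i).supp.Nonempty) ∧
      Nonempty (M ≅ directSum fun i => (B i).blockModule k) := by
  choose shape hshape using exists_shape_supp_eq
  choose n e hbasis hzero hrho using
    fun d : {p // (cellRegion p).Nonempty} => hM.exists_basis_cell hpfd d.2
  refine ⟨Σ d, Fin (n d), fun i => shape i.1.1, fun i => (hshape i.1.1).symm ▸ i.1.2, ?_⟩
  -- The members of the family that live over `t` are the basis vectors of the cells of `M.obj t`.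
  have hb : ∀ t, ∃ b : Module.Basis
      (Σ d : {p | t ∈ cellRegion p}, Fin (n ⟨d.1, t, d.2⟩)) k (M.obj t),
      ⇑b = fun x => e ⟨x.1.1, t, x.1.2⟩ t x.2 := fun t => by
    have := hpfd t
    exact Flag.exists_basis_sigma (hM.monotone_flagX t) (hM.monotone_flagY t)
      ⟨_, flagX_inr_self t⟩ ⟨_, flagY_inr_self t⟩
      (D := {p | t ∈ cellRegion p}) (κ := fun d => Fin (n ⟨d.1, t, d.2⟩))
      (e := fun d : {p | t ∈ cellRegion p} => e ⟨d.1, t, d.2⟩ t)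
      (fun d => hbasis ⟨d.1, t, d.2⟩ t d.2) fun p hp => cellUpper_le_cellLower hp
  refine nonempty_iso_directSum_blockModule _ (fun i t => e i.1 t i.2)
    (fun i t ht => ?_) (fun i s t h hs => ?_) (fun t => ?_) (fun t => ?_)
  · rw [hshape] at ht
    rw [hzero _ t ht]
    rfl
  · rw [hshape] at hs
    exact hrho i.1 s t h hs i.2
  · obtain ⟨b, hb⟩ := hb t
    have hli := b.linearIndependent
    rw [hb] at hli
    simp only [hshape]
    let g : {i : Σ d, Fin (n d) | t ∈ cellRegion i.1.1} →
        Σ d : {p | t ∈ cellRegion p}, Fin (n ⟨d.1, t, d.2⟩) := fun i => ⟨⟨i.1.1.1, i.2⟩, i.1.2⟩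
    have hg : Function.Injective g := by
      rintro ⟨⟨⟨p, hp⟩, i⟩, hi⟩ ⟨⟨⟨q, hq⟩, j⟩, hj⟩ h
      simp only [g, Sigma.mk.injEq, Subtype.mk.injEq] at h
      obtain ⟨rfl, h⟩ := h
      rw [eq_of_heq h]
    exact hli.comp g hg
  · obtain ⟨b, hb⟩ := hb t
    rw [eq_top_iff, ← b.span_eq, hb]
    simp only [hshape]
    refine Submodule.span_mono ?_
    rintro _ ⟨⟨⟨p, hp⟩, i⟩, rfl⟩
    exact ⟨⟨⟨p, t, hp⟩, i⟩, hp, rfl⟩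

end

end PersistenceBimodule

/-! ### Morphisms between block modules -/

namespace PersistenceBimodule

section

variable {k : Type u} [Field k] {S T W : Set (ℝ × ℝ)} {hS : S.OrdConnected} {hT : T.OrdConnected}
  {hW : W.OrdConnected}

open Classical in
/-- The unit vector of the support module of `S` at `t`; it is zero if `t ∉ S`. -/
noncomputable def supportUnit (k : Type u) [Field k] {S : Set (ℝ × ℝ)} (hS : S.OrdConnected)
    (t : ℝ × ℝ) : (supportModule k S hS).obj t :=
  (if h : t ∈ S then ⟨1, by simp [supportSpace, h]⟩ else 0 : supportSpace k S t)

/-- The coordinate of an element of a support module at a point. -/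
noncomputable def supportCoord (k : Type u) [Field k] {S : Set (ℝ × ℝ)} (hS : S.OrdConnected)
    (t : ℝ × ℝ) : (supportModule k S hS).obj t →ₗ[k] k :=
  (supportSpace k S t).subtype

theorem supportCoord_injective (t : ℝ × ℝ) : Function.Injective (supportCoord k hS t) :=
  Subtype.val_injective

theorem supportModule_eq_zero {t : ℝ × ℝ} (ht : t ∉ S) (x : (supportModule k S hS).obj t) :
    x = 0 :=
  eq_zero_of_notMem ht x

theorem supportCoord_unit {t : ℝ × ℝ} (ht : t ∈ S) :
    supportCoord k hS t (supportUnit k hS t) = 1 := by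
  simp only [supportCoord, supportUnit, ht, dite_true]
  rfl

theorem supportCoord_rho {s t : ℝ × ℝ} (h : s ≤ t) (hs : s ∈ S) (ht : t ∈ S)
    (x : (supportModule k S hS).obj s) :
    supportCoord k hS t ((supportModule k S hS).rho h x) = supportCoord k hS s x := by
  change (supportMap k S s t x : k) = Subtype.val (p := (· ∈ supportSpace k S s)) x
  rw [supportMap, dif_pos ⟨hs, ht⟩]
  rfl

theorem supportCoord_smul_unit {t : ℝ × ℝ} (x : (supportModule k S hS).obj t) :
    supportCoord k hS t x • supportUnit k hS t = x := by
  by_cases ht : t ∈ S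
  · refine supportCoord_injective t ?_
    rw [map_smul, supportCoord_unit ht, smul_eq_mul, mul_one]
  · exact (supportModule_eq_zero ht _).trans (supportModule_eq_zero ht _).symm

/-- The scalar by which a morphism of support modules acts at `t`. -/
noncomputable def coeffAt (f : supportModule k S hS ⟶ supportModule k T hT) (t : ℝ × ℝ) : k :=
  supportCoord k hT t ((f.app t).hom (supportUnit k hS t))

theorem app_supportUnit (f : supportModule k S hS ⟶ supportModule k T hT) (t : ℝ × ℝ) :
    (f.app t).hom (supportUnit k hS t) = coeffAt f t • supportUnit k hT t :=
  (supportCoord_smul_unit _).symm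

theorem coeffAt_id {t : ℝ × ℝ} (ht : t ∈ S) : coeffAt (𝟙 (supportModule k S hS)) t = 1 :=
  supportCoord_unit ht

theorem coeffAt_zero (t : ℝ × ℝ) :
    coeffAt (0 : supportModule k S hS ⟶ supportModule k T hT) t = 0 :=
  map_zero (supportCoord k hT t)

theorem coeffAt_comp (f : supportModule k S hS ⟶ supportModule k T hT)
    (g : supportModule k T hT ⟶ supportModule k W hW) (t : ℝ × ℝ) :
    coeffAt (f ≫ g) t = coeffAt f t * coeffAt g t := by
  rw [coeffAt, comp_app_hom_apply, app_supportUnit, map_smul, map_smul, smul_eq_mul]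
  rfl

theorem coeffAt_eq_zero_left (f : supportModule k S hS ⟶ supportModule k T hT) {t : ℝ × ℝ}
    (ht : t ∉ S) : coeffAt f t = 0 := by
  rw [coeffAt, supportModule_eq_zero ht (supportUnit k hS t), map_zero, map_zero]

theorem coeffAt_eq_zero_right (f : supportModule k S hS ⟶ supportModule k T hT) {t : ℝ × ℝ}
    (ht : t ∉ T) : coeffAt f t = 0 := by
  rw [coeffAt, supportModule_eq_zero ht ((f.app t).hom _), map_zero]

theorem coeffAt_eq_of_le (f : supportModule k S hS ⟶ supportModule k S hS) {s t : ℝ × ℝ}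
    (h : s ≤ t) (hs : s ∈ S) (ht : t ∈ S) : coeffAt f s = coeffAt f t := by
  have hunit : (supportModule k S hS).rho h (supportUnit k hS s) = supportUnit k hS t :=
    supportCoord_injective t (by rw [supportCoord_rho h hs ht, supportCoord_unit hs,
      supportCoord_unit ht])
  rw [coeffAt, coeffAt, ← hunit, rho_naturality, supportCoord_rho h hs ht]

/-- If `S` is closed under infima, then an endomorphism of its support module is a scalar. -/
theorem coeffAt_eq (hinf : InfClosed S) (f : supportModule k S hS ⟶ supportModule k S hS)
    {s t : ℝ × ℝ} (hs : s ∈ S) (ht : t ∈ S) : coeffAt f s = coeffAt f t :=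
  (coeffAt_eq_of_le f inf_le_left (hinf hs ht) hs).symm.trans
    (coeffAt_eq_of_le f inf_le_right (hinf hs ht) ht)

/-- An endomorphism of a support module that factors through the support module of a different set
vanishes: a nonzero scalar would force either set to contain the other. -/
theorem coeffAt_comp_eq_zero (hinfS : InfClosed S) (hinfT : InfClosed T) (hne : S ≠ T)
    (f : supportModule k S hS ⟶ supportModule k T hT)
    (g : supportModule k T hT ⟶ supportModule k S hS) (t : ℝ × ℝ) : coeffAt (f ≫ g) t = 0 := by
  by_contra h
  have htS : t ∈ S := by
    by_contra ht
    exact h (coeffAt_eq_zero_left _ ht)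
  have h' : coeffAt (g ≫ f) t ≠ 0 := by
    rw [coeffAt_comp] at h ⊢
    rwa [mul_comm]
  have htT : t ∈ T := by
    by_contra ht
    exact h' (coeffAt_eq_zero_left _ ht)
  refine hne (Set.Subset.antisymm (fun r hr => ?_) fun r hr => ?_)
  · by_contra hrT
    rw [coeffAt_eq hinfS _ htS hr, coeffAt_comp, coeffAt_eq_zero_right f hrT, zero_mul] at h
    exact h rfl
  · by_contra hrS
    rw [coeffAt_eq hinfT _ htT hr, coeffAt_comp, coeffAt_eq_zero_right g hrS, zero_mul] at h'
    exact h' rfl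

theorem not_isZero_supportModule (h : S.Nonempty) : ¬Limits.IsZero (supportModule k S hS) := by
  intro hz
  obtain ⟨t, ht⟩ := h
  have h1 := coeffAt_id (k := k) (hS := hS) ht
  rw [hz.eq_of_src (𝟙 _) 0, coeffAt_zero] at h1
  exact zero_ne_one h1

theorem nonempty_iso_supportModule (h : S = T) :
    Nonempty (supportModule k S hS ≅ supportModule k T hT) := by
  subst h
  exact ⟨Iso.refl _⟩

end

end PersistenceBimodule

theorem Shape.infClosed_supp (B : Shape) : InfClosed B.supp := by
  have hLe : ∀ (c : DecoratedReal) {x y : ℝ}, c.LeReal x → c.LeReal y → c.LeReal (x ⊓ y) :=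
    fun c _ _ hx hy => min_rec' c.LeReal hx hy
  have hGe : ∀ (c : DecoratedReal) {x y : ℝ}, c.GeReal x → c.GeReal y → c.GeReal (x ⊓ y) :=
    fun c _ _ hx hy => min_rec' c.GeReal hx hy
  obtain ⟨_ | _ | _ | _, x, y⟩ := B
  · exact fun a ha b hb => ⟨hLe _ ha.1 hb.1, hLe _ ha.2 hb.2⟩
  · exact fun a ha b hb => ⟨hGe _ ha.1 hb.1, hGe _ ha.2 hb.2⟩
  · exact fun a ha b hb => ⟨hLe _ ha.1 hb.1, hGe _ ha.2 hb.2⟩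
  · exact fun a ha b hb => ⟨hLe _ ha.1 hb.1, hGe _ ha.2 hb.2⟩

/-! ### Uniqueness of the decomposition -/

namespace PersistenceBimodule

section

/-- A decomposition of `M` as the direct sum of the bimodules `N j`, given by the inclusions and
the projections. The index type may live in any universe, which is not so for an isomorphism
with `directSum N`. -/
structure Decomposition {k : Type u} [Field k] {J : Type w} (M : PersistenceBimodule.{u, v} k)
    (N : J → PersistenceBimodule.{u, v} k) where
  inc : ∀ j, N j ⟶ M
  proj : ∀ j, M ⟶ N j
  inc_proj_self : ∀ j, inc j ≫ proj j = 𝟙 (N j)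
  inc_proj_of_ne : ∀ i j, i ≠ j → inc i ≫ proj j = 0
  exists_finset : ∀ t (x : M.obj t), ∃ s : Finset J, (∀ j ∉ s, ((proj j).app t).hom x = 0) ∧
    x = ∑ j ∈ s, ((inc j).app t).hom (((proj j).app t).hom x)

namespace Decomposition

variable {k : Type u} [Field k]

open Classical in
/-- The decomposition given by an isomorphism with a direct sum. -/
noncomputable def ofIso {J : Type w} {N : J → PersistenceBimodule.{u, max w v} k}
    {M : PersistenceBimodule.{u, max w v} k} (φ : M ≅ directSum N) : Decomposition M N where
  inc j := directSumι N j ≫ φ.inv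
  proj j := φ.hom ≫ directSumπ N j
  inc_proj_self j := by
    rw [Category.assoc, φ.inv_hom_id_assoc, directSumι_π_self]
  inc_proj_of_ne i j h := by
    rw [Category.assoc, φ.inv_hom_id_assoc, directSumι_π_of_ne h]
  exists_finset t x := by
    let y : ⨁ j, (N j).obj t := (φ.hom.app t).hom x
    refine ⟨DFinsupp.support y, fun j hj => DFinsupp.notMem_support_iff.1 hj, ?_⟩
    have hy : y = ∑ j ∈ DFinsupp.support y, DirectSum.lof k J (fun j => (N j).obj t) j (y j) :=
      (DirectSum.sum_support_of y).symm
    have hx : x = (φ.inv.app t).hom y :=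
      (congrArg (fun f => (f.app t).hom x) φ.hom_inv_id).symm
    exact hx.trans ((congrArg (φ.inv.app t).hom hy).trans (map_sum (φ.inv.app t).hom _ _))

/-- Replacing the summands by isomorphic ones. -/
noncomputable def congr {J : Type w} {M : PersistenceBimodule.{u, v} k}
    {N N' : J → PersistenceBimodule.{u, v} k} (d : Decomposition M N) (e : ∀ j, N j ≅ N' j) :
    Decomposition M N' where
  inc j := (e j).inv ≫ d.inc j
  proj j := d.proj j ≫ (e j).hom
  inc_proj_self j := by
    rw [Category.assoc, ← Category.assoc (d.inc j), d.inc_proj_self, Category.id_comp,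
      Iso.inv_hom_id]
  inc_proj_of_ne i j h := by
    rw [Category.assoc, ← Category.assoc (d.inc i), d.inc_proj_of_ne i j h, Limits.zero_comp,
      Limits.comp_zero]
  exists_finset t x := by
    obtain ⟨s, hs, hx⟩ := d.exists_finset t x
    refine ⟨s, fun j hj => ?_, hx.trans (Finset.sum_congr rfl fun j _ => ?_)⟩
    · rw [comp_app_hom_apply, hs j hj, map_zero]
    · have : ((d.proj j ≫ (e j).hom) ≫ (e j).inv ≫ d.inc j) = d.proj j ≫ d.inc j := by simp
      exact (congrArg (fun f => (f.app t).hom x) this).symm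

variable {I : Type w} {J : Type*} {M : PersistenceBimodule.{u, u} k} {X : I → Set (ℝ × ℝ)}
  {Y : J → Set (ℝ × ℝ)} {hX : ∀ i, (X i).OrdConnected} {hY : ∀ j, (Y j).OrdConnected}

theorem finite_support_eq (hpfd : M.IsPfd)
    (d : Decomposition M fun i => supportModule k (X i) (hX i))
    {S : Set (ℝ × ℝ)} (hS : S.Nonempty) : Finite {i // X i = S} := by
  obtain ⟨t, ht⟩ := hS
  have := hpfd t
  have hli : LinearIndependent k fun i : {i // X i = S} =>
      ((d.inc i).app t).hom (supportUnit k (hX i) t) := by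
    rw [linearIndependent_iff']
    intro s g hg i hi
    have h0 := congrArg ((d.proj i).app t).hom hg
    rw [map_sum, map_zero, Finset.sum_eq_single i] at h0
    · rw [map_smul, ← comp_app_hom_apply, d.inc_proj_self] at h0
      have h1 := congrArg (supportCoord k (hX i) t) h0
      rw [map_smul, map_zero] at h1
      change g i * supportCoord k (hX i) t (supportUnit k (hX i) t) = 0 at h1
      rwa [supportCoord_unit (i.2.symm ▸ ht), mul_one] at h1
    · intro j _ hj
      rw [map_smul, ← comp_app_hom_apply, d.inc_proj_of_ne _ _ fun h => hj (Subtype.ext h)]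
      exact smul_zero _
    · exact fun h => absurd hi h
  exact hli.finite_of_isNoetherian

/-- The entries of the change of decomposition between the summands with support `S`. -/
noncomputable def blockMatrix (d : Decomposition M fun i => supportModule k (X i) (hX i))
    (d' : Decomposition M fun j => supportModule k (Y j) (hY j)) (S : Set (ℝ × ℝ)) (t : ℝ × ℝ) :
    Matrix {i // X i = S} {j // Y j = S} k :=
  fun i j => coeffAt (d.inc i ≫ d'.proj j) t

/-- The change of decomposition is invertible already between the summands with support `S`, as
the intermediate summands with a different support do not contribute. -/
theorem blockMatrix_mul_blockMatrix
    (d : Decomposition M fun i => supportModule k (X i) (hX i))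
    (d' : Decomposition M fun j => supportModule k (Y j) (hY j)) (hXinf : ∀ i, InfClosed (X i))
    (hYinf : ∀ j, InfClosed (Y j)) {S : Set (ℝ × ℝ)} {t : ℝ × ℝ} (ht : t ∈ S)
    [Fintype {j // Y j = S}] [DecidableEq {i // X i = S}] :
    d.blockMatrix d' S t * d'.blockMatrix d S t = 1 := by
  classical
  ext ⟨i, hi⟩ ⟨i', hi'⟩
  let c : J → k := fun j => coeffAt (d.inc i ≫ d'.proj j) t * coeffAt (d'.inc j ≫ d.proj i') t
  obtain ⟨s, hs, hx⟩ := d'.exists_finset t (((d.inc i).app t).hom (supportUnit k (hX i) t))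
  have hc0 : ∀ j ∉ s, c j = 0 := fun j hj => by
    have : coeffAt (d.inc i ≫ d'.proj j) t = 0 := by
      rw [coeffAt, comp_app_hom_apply, hs j hj, map_zero]
    simp only [c, this, zero_mul]
  have hcne : ∀ j, Y j ≠ S → c j = 0 := fun j hj => by
    simp only [c]
    rw [← coeffAt_comp]
    have key : ∀ (T : Set (ℝ × ℝ)) (hT : T.OrdConnected), T = S →
        ∀ f : supportModule k (Y j) (hY j) ⟶ supportModule k T hT,
        coeffAt ((d.inc i ≫ d'.proj j) ≫ f) t = 0 := by
      rintro T hT h f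
      obtain rfl : T = X i := h.trans hi.symm
      exact coeffAt_comp_eq_zero (hXinf i) (hYinf j) (fun h => hj (h.symm.trans hi)) _ _ t
    exact key (X i') (hX i') hi' _
  have hsum : coeffAt (d.inc i ≫ d.proj i') t = ∑ j ∈ s, c j := by
    rw [coeffAt, comp_app_hom_apply, hx, map_sum, map_sum]
    exact Finset.sum_congr rfl fun j _ =>
      coeffAt_comp (d.inc i ≫ d'.proj j) (d'.inc j ≫ d.proj i') t
  have hsum' : ∑ j ∈ s, c j = ∑ j : {j // Y j = S}, c j := by
    let T : Finset J := Finset.univ.map (Function.Embedding.subtype fun j => Y j = S)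
    have hT : ∑ j : {j // Y j = S}, c j = ∑ j ∈ T, c j := by
      rw [Finset.sum_map]
      rfl
    have hcT : ∀ j ∉ T, c j = 0 := fun j hj => hcne j fun h => hj (by simpa [T] using h)
    rw [hT, Finset.sum_subset (Finset.subset_union_left (s₂ := T)) fun j _ hj => hc0 j hj,
      Finset.sum_subset (Finset.subset_union_right (s₁ := s)) fun j _ hj => hcT j hj]
  rw [Matrix.mul_apply]
  refine hsum'.symm.trans (hsum.symm.trans ?_)
  by_cases h : i = i'
  · subst h
    rw [d.inc_proj_self, Matrix.one_apply_eq]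
    exact coeffAt_id (hi.symm ▸ ht)
  · rw [d.inc_proj_of_ne _ _ h, Matrix.one_apply_ne fun h' => h (congrArg Subtype.val h')]
    exact coeffAt_zero t

/-- The number of summands with a given support does not depend on the decomposition. -/
theorem exists_equiv_support_eq (hpfd : M.IsPfd)
    (d : Decomposition M fun i => supportModule k (X i) (hX i))
    (d' : Decomposition M fun j => supportModule k (Y j) (hY j)) (hXinf : ∀ i, InfClosed (X i))
    (hYinf : ∀ j, InfClosed (Y j)) (hXne : ∀ i, (X i).Nonempty) (hYne : ∀ j, (Y j).Nonempty) :
    ∃ e : J ≃ I, ∀ j, Y j = X (e j) := by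
  classical
  have hfib : ∀ S : Set (ℝ × ℝ), Nonempty ({j // Y j = S} ≃ {i // X i = S}) := by
    intro S
    rcases S.eq_empty_or_nonempty with rfl | hS
    · have h1 : IsEmpty {j // Y j = ∅} := ⟨fun j => (hYne j).ne_empty j.2⟩
      have h2 : IsEmpty {i // X i = ∅} := ⟨fun i => (hXne i).ne_empty i.2⟩
      exact ⟨Equiv.equivOfIsEmpty _ _⟩
    · have := d.finite_support_eq hpfd hS
      have := d'.finite_support_eq hpfd hS
      have := Fintype.ofFinite {i // X i = S}
      have := Fintype.ofFinite {j // Y j = S}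
      obtain ⟨t, ht⟩ := hS
      exact ⟨Matrix.indexEquivOfInv (d'.blockMatrix_mul_blockMatrix d hYinf hXinf ht)
        (d.blockMatrix_mul_blockMatrix d' hXinf hYinf ht)⟩
  let f : ∀ S, {j // Y j = S} ≃ {i // X i = S} := fun S => (hfib S).some
  refine ⟨(Equiv.sigmaFiberEquiv Y).symm.trans
    ((Equiv.sigmaCongrRight f).trans (Equiv.sigmaFiberEquiv X)), fun j => ?_⟩
  exact (f _ ⟨j, rfl⟩).2.symm

end Decomposition

end

end PersistenceBimodule

/-! ### Indecomposable summands -/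

namespace PersistenceBimodule

section

variable {k : Type u} [Field k]

theorem psi_phi (M : PersistenceBimodule.{u, v} k) {s t : ℝ × ℝ} (h : s ≤ t) (x : M.obj s) :
    M.psi h (M.phi h x) = 0 := by
  simp only [psi, phi, LinearMap.prod_apply, Function.prod_apply, LinearMap.coprod_apply,
    LinearMap.neg_apply, rho_rho]
  exact add_neg_cancel _

theorem app_app_of_comp_eq_id {M N : PersistenceBimodule.{u, v} k} {i : N ⟶ M} {p : M ⟶ N}
    (h : i ≫ p = 𝟙 N) (t : ℝ × ℝ) (x : N.obj t) : (p.app t).hom ((i.app t).hom x) = x :=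
  congrArg (fun f => (f.app t).hom x) h

theorem IsPfd.of_retract {M N : PersistenceBimodule.{u, v} k} (hM : M.IsPfd) {i : N ⟶ M}
    {p : M ⟶ N} (h : i ≫ p = 𝟙 N) : N.IsPfd := fun t => by
  have := hM t
  exact Module.Finite.of_injective (i.app t).hom
    (Function.LeftInverse.injective (app_app_of_comp_eq_id h t))

theorem IsExact.of_retract {M N : PersistenceBimodule.{u, v} k} (hM : M.IsExact) {i : N ⟶ M}
    {p : M ⟶ N} (h : i ≫ p = 𝟙 N) : N.IsExact := by
  refine fun s t hst => le_antisymm ?_ ?_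
  · rintro _ ⟨x, rfl⟩
    exact N.psi_phi hst x
  · rintro ⟨a, b⟩ hab
    have hab' : N.rho (s := (t.1, s.2)) (t := t) ⟨le_rfl, hst.2⟩ a =
        N.rho (s := (s.1, t.2)) (t := t) ⟨hst.1, le_rfl⟩ b := by
      have : N.rho (s := (t.1, s.2)) (t := t) ⟨le_rfl, hst.2⟩ a +
        -N.rho (s := (s.1, t.2)) (t := t) ⟨hst.1, le_rfl⟩ b = 0 := hab
      exact add_neg_eq_zero.1 this
    obtain ⟨w, hw, hw'⟩ := hM.exists_of_rho_eq hst.1 hst.2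
      (a := (i.app (t.1, s.2)).hom a) (b := (i.app (s.1, t.2)).hom b)
      (by rw [← rho_naturality, ← rho_naturality]; exact congrArg _ hab')
    refine ⟨(p.app s).hom w, Prod.ext ?_ ?_⟩
    · refine (rho_naturality p _ w).symm.trans ?_
      exact (congrArg _ hw).trans (app_app_of_comp_eq_id h _ a)
    · refine (rho_naturality p _ w).symm.trans ?_
      exact (congrArg _ hw').trans (app_app_of_comp_eq_id h _ b)

/-- A nonzero retract of an indecomposable bimodule is isomorphic to it. -/
theorem nonempty_iso_of_indecomposable {N B : PersistenceBimodule.{u, v} k}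
    (hN : Indecomposable N) (hB : ¬Limits.IsZero B) {i : B ⟶ N} {p : N ⟶ B} (h : i ≫ p = 𝟙 B) :
    Nonempty (N ≅ B) := by
  have : IsSplitEpi p := ⟨⟨i, h⟩⟩
  have hbil := Limits.isBilimitBinaryBiconeOfIsSplitEpiOfKernel (Limits.kernelIsKernel p)
  have hker := (hN.2 _ _ (Limits.biprod.uniqueUpToIso _ _ hbil)).resolve_right hB
  have : Mono p := Preadditive.mono_of_isZero_kernel p hker
  have : IsIso p := isIso_of_mono_of_isSplitEpi p
  exact ⟨asIso p⟩

/-- An indecomposable summand of an exact pointwise finite-dimensional bimodule inherits these two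
properties, so that it is a direct sum of block modules itself, hence a single one. -/
theorem exists_iso_blockModule_of_indecomposable {M N : PersistenceBimodule.{u, u} k}
    (hpfd : M.IsPfd) (hM : M.IsExact) (hN : Indecomposable N) {i : N ⟶ M} {p : M ⟶ N}
    (h : i ≫ p = 𝟙 N) :
    ∃ C : Shape, C.supp.Nonempty ∧ Nonempty (N ≅ C.blockModule k) := by
  obtain ⟨I, B, hB, ⟨φ⟩⟩ := (hM.of_retract h).exists_iso_directSum_blockModule (hpfd.of_retract h)
  let d := Decomposition.ofIso.{u, u, 0} φ
  have hne : Nonempty I := by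
    by_contra hI
    rw [not_nonempty_iff] at hI
    refine hN.1 ((Limits.IsZero.iff_id_eq_zero N).2 ?_)
    ext t x
    obtain ⟨s, -, hx⟩ := d.exists_finset t x
    rw [Finset.eq_empty_of_isEmpty s, Finset.sum_empty] at hx
    exact hx
  obtain ⟨j⟩ := hne
  exact ⟨B j, hB j, nonempty_iso_of_indecomposable hN (not_isZero_supportModule (hB j))
    (d.inc_proj_self j)⟩

end

end PersistenceBimodule

theorem theorem1p1 {k : Type u} [Field k] (M : PersistenceBimodule.{u, u} k)
    (hpfd : M.IsPfd) (hexact : M.IsExact) :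
    ∃ (I : Type) (B : I → Shape),
      (∀ i, (B i).supp.Nonempty) ∧
      Nonempty (M ≅ PersistenceBimodule.directSum fun i => (B i).blockModule k) ∧
      -- uniqueness among decompositions into (nonzero) block modules
      (∀ (J : Type u) (C : J → Shape), (∀ j, (C j).supp.Nonempty) →
        Nonempty (M ≅ PersistenceBimodule.directSum fun j => (C j).blockModule k) →
        ∃ e : J ≃ I, ∀ j, Nonempty ((C j).blockModule k ≅ (B (e j)).blockModule k)) ∧
      -- uniqueness among all decompositions into indecomposable bimodules
      (∀ (J : Type u) (N : J → PersistenceBimodule.{u, u} k), (∀ j, Indecomposable (N j)) →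
        Nonempty (M ≅ PersistenceBimodule.directSum N) →
        ∃ e : J ≃ I, ∀ j, Nonempty (N j ≅ (B (e j)).blockModule k)) := by
  obtain ⟨I, B, hB, ⟨φ⟩⟩ := hexact.exists_iso_directSum_blockModule hpfd
  let d := PersistenceBimodule.Decomposition.ofIso.{u, u, 0} φ
  have huniq : ∀ (J : Type u) (C : J → Shape), (∀ j, (C j).supp.Nonempty) →
      PersistenceBimodule.Decomposition M (fun j => (C j).blockModule k) →
      ∃ e : J ≃ I, ∀ j, Nonempty ((C j).blockModule k ≅ (B (e j)).blockModule k) := by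
    intro J C hC d'
    obtain ⟨e, he⟩ := PersistenceBimodule.Decomposition.exists_equiv_support_eq hpfd d d'
      (fun i => (B i).infClosed_supp) (fun j => (C j).infClosed_supp) hB hC
    exact ⟨e, fun j => PersistenceBimodule.nonempty_iso_supportModule (he j)⟩
  refine ⟨I, B, hB, ⟨φ⟩, fun J C hC ⟨ψ⟩ => huniq J C hC (.ofIso.{u, u, u} ψ), ?_⟩
  intro J N hN ⟨ψ⟩
  let d' := PersistenceBimodule.Decomposition.ofIso.{u, u, u} ψ
  choose C hC hiso using fun j =>
    PersistenceBimodule.exists_iso_blockModule_of_indecomposable hpfd hexact (hN j)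
      (d'.inc_proj_self j)
  obtain ⟨e, he⟩ := huniq J C hC (d'.congr fun j => (hiso j).some)
  exact ⟨e, fun j => ⟨(hiso j).some.trans (he j).some⟩⟩
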